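/- Let $L$ be a first-order language and $T$ a complete $L$-theory. Tuples are finite, "model" means non-empty model, and a formula $\varphi(x,y)$ is an $L$-formula with $x,y$ finite tuples of variables. We use the following notions, for a model $M$ of $T$. A sequence $\langle a_i : i<\omega\rangle$ of tuples of $M$ of the same length is *indiscernible* if for all $k$ and all $i_1<\dots<i_k$, $j_1<\dots<j_k$, the tuples $a_{i_1}\cdots a_{i_k}$ and $a_{j_1}\cdots a_{j_k}$ satisfy the same $L$-formulas in $M$. A family $\{\varphi(x,d_i) : i\in I\}$ with parameters in $M$ is *consistent* if every finite subfamily is realized in $M$; it is *$k$-inconsistent* if for any $k$ distinct indices $i_1,\dots,i_k$ no tuple of $M$ satisfies $\varphi(x,d_{i_1})\wedge\dots\wedge\varphi(x,d_{i_k})$. For a tuple $b$ of $M$ and $A\subseteq M$, the formula $\varphi(x,b)$ *divides over $A$* if for some $k<\omega$ there are, in some elementary extension of $M$, tuples $d_i$ ($i<\omega$) with $\operatorname{tp}(d_i/A)=\operatorname{tp}(b/A)$ for all $i$ such that $\{\varphi(x,d_i) : i<\omega\}$ is $k$-inconsistent. $T$ is *NTP$_2$* if there are no formula $\varphi(x,y)$,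 $k<\omega$, model of $T$ and array $\langle d_{i,j} : i,j<\omega\rangle$ of tuples in it such that $\{\varphi(x,d_{i,\eta(i)}) : i<\omega\}$ is consistent for every $\eta:\omega\to\omega$ and $\{\varphi(x,d_{i,j}) : j<\omega\}$ is $k$-inconsistent for every $i$. $T$ is *$\omega$-resilient* if, whenever $\langle a_i : i<\omega\rangle$ and $\langle b_i : i<\omega\rangle$ are indiscernible sequences of tuples of the same length in a model of $T$ such that for every $k<\omega$ the sequence $\langle a_i : i\le k\rangle+\langle b_k\rangle+\langle a_i : k<i<\omega\rangle$ is indiscernible, then for every formula $\varphi(x,y)$, if $\{\varphi(x,a_i) : i<\omega\}$ is consistent, so is $\{\varphi(x,b_i) : i<\omega\}$. **Theorem.** Suppose that $T$ is $\omega$-resilient and NTP$_2$. Let $M$ be a model of $T$, let $\langle a_i : i<\omega\rangle$ be an indiscernible sequence of tuples of $M$ of the length of $x$, let $b$ be a tuple of $M$, and suppose that $\varphi(x,b)$ divides over the set of all coordinates of the tuples $a_{2i}$, $i<\omega$. Then $M\models\neg\varphi(a_i,b)$ for all but finitely many $i<\omega$. -/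

import Mathlib

open FirstOrder

universe u v w

namespace FirstOrder.Language

variable {L : Language.{u, v}}

section Structure

variable {M : Type w} [L.Structure M] {n m : ℕ}

/-- The sequence `⟨a i : i < ω⟩` of `n`-tuples of `M` is indiscernible (over the empty set): any two
increasing finite subsequences of the same length satisfy the same `L`-formulas. -/
def IndiscernibleSeq (L : Language.{u, v}) {M : Type w} [L.Structure M] {n : ℕ}
    (a : ℕ → Fin n → M) : Prop :=
  ∀ (k : ℕ) (ψ : L.Formula (Fin k × Fin n)) (i j : Fin k → ℕ), StrictMono i → StrictMono j →
    (ψ.Realize (fun p => a (i p.1) p.2) ↔ ψ.Realize (fun p => a (j p.1) p.2))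

/-- The sequence `⟨a i : i ≤ k⟩ + ⟨c⟩ + ⟨a i : k < i < ω⟩`, re-indexed by `ω`. -/
def insertAfter {X : Type w} (a : ℕ → X) (k : ℕ) (c : X) : ℕ → X :=
  fun i => if i ≤ k then a i else if i = k + 1 then c else a (i - 1)

/-- The family of formulas `{φ(x, d i) : i ∈ ι}` with parameters in `M` is consistent, that is,
finitely satisfiable in `M`. -/
def ConsistentFamily {ι : Type} (φ : L.Formula (Fin n ⊕ Fin m)) (d : ι → Fin m → M) : Prop :=
  ∀ s : Finset ι, ∃ c : Fin n → M, ∀ i ∈ s, φ.Realize (Sum.elim c (d i))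

/-- The family `⟨φ(x, d i) : i ∈ ι⟩` is `k`-inconsistent: for any `k` different indices, the
corresponding formulas have no common solution. -/
def InconsistentFamily (k : ℕ) {ι : Type} (φ : L.Formula (Fin n ⊕ Fin m)) (d : ι → Fin m → M) :
    Prop :=
  ∀ s : Finset ι, s.card = k → ¬ ∃ c : Fin n → M, ∀ i ∈ s, φ.Realize (Sum.elim c (d i))

/-- `b` and `b'` have the same complete type over the set `A` in `M`. -/
def SameTypeOver (L : Language.{u, v}) {M : Type w} [L.Structure M] {m : ℕ}
    (A : Set M) (b b' : Fin m → M) : Prop :=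
  ∀ ψ : L.Formula (A ⊕ Fin m),
    ψ.Realize (Sum.elim (fun x : A => (x : M)) b) ↔ ψ.Realize (Sum.elim (fun x : A => (x : M)) b')

/-- The formula `φ(x, b)` divides over the set `A`: for some `k` there is, in some elementary
extension of `M`, a sequence `⟨d i : i < ω⟩` of realizations of the type of `b` over `A` such that
`⟨φ(x, d i) : i < ω⟩` is `k`-inconsistent. -/
def Divides (φ : L.Formula (Fin n ⊕ Fin m)) (b : Fin m → M) (A : Set M) : Prop :=
  ∃ (N : Type (max u v w)) (_ : L.Structure N) (f : M ↪ₑ[L] N) (k : ℕ) (d : ℕ → Fin m → N),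
    (∀ i, SameTypeOver L (f '' A) (d i) (f ∘ b)) ∧ InconsistentFamily k φ d

end Structure

namespace Theory

/-- The formula `φ(x, y)` has the tree property of the second kind in `T`: in some model of `T`
there is an array `⟨d i j : i, j < ω⟩` such that all vertical paths are consistent and, for some
fixed `k`, all rows are `k`-inconsistent. -/
def HasTP₂ (T : L.Theory) {n m : ℕ} (φ : L.Formula (Fin n ⊕ Fin m)) : Prop :=
  ∃ (M : ModelType.{u, v, max u v} T) (d : ℕ → ℕ → Fin m → M) (k : ℕ),
    (∀ η : ℕ → ℕ, ConsistentFamily φ (fun i => d i (η i))) ∧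
      ∀ i, InconsistentFamily k φ (d i)

/-- No formula `φ(x, y)` has the tree property of the second kind in `T`. -/
def IsNTP₂ (T : L.Theory) : Prop :=
  ∀ (n m : ℕ) (φ : L.Formula (Fin n ⊕ Fin m)), ¬ T.HasTP₂ φ

/-- `T` is `ω`-resilient: in every model of `T`, if `⟨a i : i < ω⟩` and `⟨b i : i < ω⟩` are
indiscernible and `⟨a i : i ≤ k⟩ + ⟨b k⟩ + ⟨a i : k < i < ω⟩` is indiscernible for every `k`, then
for every `φ(x, y)`, if `{φ(x, a i) : i < ω}` is consistent, so is `{φ(x, b i) : i < ω}`. -/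
def IsOmegaResilient (T : L.Theory) : Prop :=
  ∀ (M : ModelType.{u, v, max u v} T) (m : ℕ) (a b : ℕ → Fin m → M),
    IndiscernibleSeq L a → IndiscernibleSeq L b →
    (∀ k, IndiscernibleSeq L (insertAfter a k (b k))) →
    ∀ (n : ℕ) (φ : L.Formula (Fin n ⊕ Fin m)), ConsistentFamily φ a → ConsistentFamily φ b

end Theory

end FirstOrder.Language

/-! Suppose `φ(a i, b)` holds for infinitely many `i`. All these `i` are odd, because a solution
lying in the base would be shared by all conjugates of `b` over the base. After thinning, `φ(x, b)`
holds at every odd term and still divides over the even ones. Dividing gives a `k`-inconsistent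
sequence `d j` of conjugates of `b` over the even terms. Conjugating the odd terms along with `b`
yields a one-row `IsConfig`: a base sequence and, for each `j`, a sequence solving `φ(x, d j)` that
interleaves with the base into a copy of `a`.

The contradiction comes from configurations with arbitrarily many rows, in which the inserted
sequence of index `l` solves `φ` at the entry `l r` of every row `r`. Such paths are consistent and
the rows are `k`-inconsistent, which the finitary form `exists_bound` of NTP₂ forbids once there are
enough rows.

The engine is `exists_conjugate_over_array`: if `α` is indiscernible over `G`, and a base
interleaves with each sequence of an indiscernible array into a copy of `α`, then a single conjugate
of `G` is related to all these copies as `G` is to `α`. Resilience passes from windows of base terms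
to windows that contain inserted terms, with array index varying along the diagonal; NTP₂, through
`row_consistent`, passes from the diagonal to all array indices at one place.

A row is added in `exists_succ`, where the engine serves twice. It first lines up infinitely many
copies of a configuration so that, whatever path is chosen in each, the resulting sequences
concatenate to a copy of `a` (`exists_joint_family`). Applied next to a stretched one-row
configuration, it gives a row over the diagonal paths (`exists_isRowOver_diagonal`). Then
`exists_common_realization` moves this row over all paths of a single configuration, and conjugating
the inserted sequences finishes the step. -/

namespace FirstOrder.Language

universe w₁ w₂ w₃

variable {L : Language.{u, v}}

/-! ### Quantification over finitely many relevant variables, and equality of types. -/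

section Formulas

variable {V : Type*} {κ : Type*} {ν : Type*} {M : Type w₁} [L.Structure M]

open Classical in
/-- Satisfaction only depends on the values of the free variables. -/
theorem Formula.realize_congr_of_freeVar (ψ : L.Formula V) {v v' : V → M}
    (h : ∀ x ∈ BoundedFormula.freeVarFinset ψ, v x = v' x) : ψ.Realize v ↔ ψ.Realize v' := by
  have h1 := BoundedFormula.realize_restrictFreeVar (L := L) (M := M) (φ := ψ)
    (f := fun a => (a : V)) (v := v) (xs := default) v (fun _ => rfl)
  have h2 : (BoundedFormula.restrictFreeVar ψ (fun a => a)).Realize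
      (fun a : BoundedFormula.freeVarFinset ψ => v a) default ↔ ψ.Realize v :=
    BoundedFormula.realize_restrictFreeVar (L := L) (M := M) v (fun _ => rfl)
  have h3 : (BoundedFormula.restrictFreeVar ψ (fun a => a)).Realize
      (fun a : BoundedFormula.freeVarFinset ψ => v a) default ↔ ψ.Realize v' :=
    BoundedFormula.realize_restrictFreeVar (L := L) (M := M) v' (fun a => h a a.2)
  exact h2.symm.trans h3

open Classical in
/-- Existential quantification over an arbitrary set of variables. -/
noncomputable def Formula.exVars (ψ : L.Formula (V ⊕ κ)) : L.Formula V :=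
  -- `κ` may be infinite, so the bound variables are indexed by the free variables of `ψ`. Those
  -- coming from `V` stay free, and their bound copies are vacuous.
  Formula.iExs (BoundedFormula.freeVarFinset ψ)
    (BoundedFormula.restrictFreeVar ψ fun a : BoundedFormula.freeVarFinset ψ =>
      (match a with
      | ⟨Sum.inl x, _⟩ => Sum.inl x
      | ⟨Sum.inr k, h⟩ => Sum.inr ⟨Sum.inr k, h⟩ : V ⊕ BoundedFormula.freeVarFinset ψ))

theorem Formula.realize_exVars [Nonempty M] (ψ : L.Formula (V ⊕ κ)) (v : V → M) :
    ψ.exVars.Realize v ↔ ∃ c : κ → M, ψ.Realize (Sum.elim v c) := by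
  classical
  unfold Formula.exVars
  rw [Formula.realize_iExs]
  constructor
  · rintro ⟨i, hi⟩
    refine ⟨fun k => if h : Sum.inr k ∈ BoundedFormula.freeVarFinset ψ then i ⟨_, h⟩
      else Classical.arbitrary M, ?_⟩
    refine (BoundedFormula.realize_restrictFreeVar _ ?_).1 hi
    rintro ⟨x | k, h⟩
    · rfl
    · simp [h]
  · rintro ⟨c, hc⟩
    refine ⟨fun a => Sum.elim v c a, ?_⟩
    refine (BoundedFormula.realize_restrictFreeVar _ ?_).2 hc
    rintro ⟨x | k, h⟩ <;> rfl

/-- The formula saying that the formulas `ψ q (x, f q)` have a common solution `x`. -/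
noncomputable def consFormula {Q : Type*} [Finite Q] (ψ : Q → L.Formula (κ ⊕ ν)) (f : Q → ν → V) :
    L.Formula V :=
  (Formula.iInf fun q => (ψ q).relabel (Sum.elim Sum.inr (Sum.inl ∘ f q))).exVars

theorem realize_consFormula [Nonempty M] {Q : Type*} [Finite Q] (ψ : Q → L.Formula (κ ⊕ ν))
    (f : Q → ν → V) (v : V → M) :
    (consFormula ψ f).Realize v ↔
      ∃ c : κ → M, ∀ q, (ψ q).Realize (Sum.elim c (fun x => v (f q x))) := by
  unfold consFormula
  rw [Formula.realize_exVars]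
  refine exists_congr fun c => ?_
  rw [Formula.realize_iInf]
  refine forall_congr' fun q => ?_
  rw [Formula.realize_relabel]
  have : (Sum.elim v c ∘ Sum.elim Sum.inr (Sum.inl ∘ f q)) =
      Sum.elim c (fun x => v (f q x)) := by
    ext x; rcases x with x | x <;> rfl
  rw [this]

end Formulas

section SameType

variable {V U : Type*} {M : Type w₁} [L.Structure M] {N : Type w₂} [L.Structure N]
  {K : Type w₃} [L.Structure K]

/-- Two assignments of values to the variables `V` satisfy the same `L`-formulas. -/
def SameType (L : Language.{u, v}) {V : Type*} {M : Type w₁} [L.Structure M] {N : Type w₂}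
    [L.Structure N] (v : V → M) (w : V → N) : Prop :=
  ∀ ψ : L.Formula V, ψ.Realize v ↔ ψ.Realize w

theorem SameType.refl (v : V → M) : SameType L v v := fun _ => Iff.rfl

theorem SameType.symm {v : V → M} {w : V → N} (h : SameType L v w) : SameType L w v :=
  fun ψ => (h ψ).symm

theorem SameType.trans {v : V → M} {w : V → N} {z : V → K} (h : SameType L v w)
    (h' : SameType L w z) : SameType L v z := fun ψ => (h ψ).trans (h' ψ)

theorem SameType.comp {v : V → M} {w : V → N} (h : SameType L v w) (f : U → V) :
    SameType L (fun x => v (f x)) (fun x => w (f x)) := fun ψ => by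
  have := h (ψ.relabel f)
  rwa [Formula.realize_relabel, Formula.realize_relabel] at this

theorem SameType.of_imp {v : V → M} {w : V → N} (h : ∀ ψ : L.Formula V, ψ.Realize v → ψ.Realize w) :
    SameType L v w := fun ψ => ⟨h ψ, fun hw => by
  by_contra hv
  exact Formula.realize_not.1 (h ψ.not (Formula.realize_not.2 hv)) hw⟩

/-- Solvability of finitely many formulas is one formula about the parameters. This is how
consistency moves between models below, in place of automorphisms of a monster model. -/
theorem SameType.exists_iff [Nonempty M] [Nonempty N] {κ ν Q : Type*} [Finite Q] {v : V → M}
    {w : V → N} (h : SameType L v w) (ψ : Q → L.Formula (κ ⊕ ν)) (f : Q → ν → V) :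
    (∃ c : κ → M, ∀ q, (ψ q).Realize (Sum.elim c (fun x => v (f q x)))) ↔
      ∃ c : κ → N, ∀ q, (ψ q).Realize (Sum.elim c (fun x => w (f q x))) := by
  rw [← realize_consFormula, ← realize_consFormula]
  exact h _

end SameType

/-! ### Compactness, limits and amalgamation. -/

section Compactness

variable {T : L.Theory}

/-- Compactness for sets of formulas. -/
theorem Theory.exists_realize_of_finset {V : Type} (S : Set (L.Formula V))
    (h : ∀ s : Finset (L.Formula V), ↑s ⊆ S → ∃ (M : Type w₁) (_ : L.Structure M) (_ : Nonempty M)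
      (_ : M ⊨ T) (v : V → M), ∀ ψ ∈ s, ψ.Realize v) :
    ∃ (M : Theory.ModelType.{u, v, max u v} T) (v : V → M), ∀ ψ ∈ S, ψ.Realize v := by
  classical
  have key : ((L.lhomWithConstants V).onTheory T ∪ Formula.equivSentence '' S).IsSatisfiable := by
    rw [Theory.isSatisfiable_iff_isFinitelySatisfiable]
    intro T0 hT0
    obtain ⟨M, iM, iN, hM, v, hv⟩ := h
      ((T0.image Formula.equivSentence.symm).filter (· ∈ S)) (by intro x; simp)
    let : (constantsOn V).Structure M := constantsOn.structure v
    have hmod : M ⊨ (T0 : L[[V]].Theory) := by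
      refine ⟨fun σ hσ => ?_⟩
      rcases hT0 hσ with h1 | ⟨ψ, hψ, rfl⟩
      · have : M ⊨ (L.lhomWithConstants V).onTheory T :=
          (LHom.onTheory_model _ T).2 inferInstance
        exact this.realize_of_mem _ h1
      · rw [Formula.realize_equivSentence]
        refine hv ψ ?_
        simp only [Finset.mem_filter, Finset.mem_image]
        exact ⟨⟨_, hσ, by simp⟩, hψ⟩
    exact Theory.Model.isSatisfiable M
  obtain ⟨M⟩ := key
  let : L.Structure M := (L.lhomWithConstants V).reduct M
  have : (L.lhomWithConstants V).IsExpansionOn M := LHom.isExpansionOn_reduct _ _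
  have hM : M ⊨ T := (LHom.onTheory_model (L.lhomWithConstants V) T).1
    (Theory.Model.mono M.is_model Set.subset_union_left)
  refine ⟨Theory.ModelType.of T M, fun a => (L.con a : M), fun ψ hψ => ?_⟩
  exact (Formula.realize_equivSentence M ψ).1
    (M.is_model.realize_of_mem _ (Or.inr ⟨ψ, hψ, rfl⟩))

/-- A limit of a sequence of assignments: every formula that holds eventually holds in the limit. -/
theorem Theory.exists_limit {V : Type} {M : ℕ → Type w₁} [∀ i, L.Structure (M i)]
    [∀ i, Nonempty (M i)] (hM : ∀ i, M i ⊨ T) (v : ∀ i, V → M i) :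
    ∃ (N : Theory.ModelType.{u, v, max u v} T) (w : V → N), ∀ ψ : L.Formula V,
      (∀ᶠ i in Filter.atTop, ψ.Realize (v i)) → ψ.Realize w := by
  refine Theory.exists_realize_of_finset
    {ψ : L.Formula V | ∀ᶠ i in Filter.atTop, ψ.Realize (v i)} fun s hs => ?_
  have : ∀ᶠ i in Filter.atTop, ∀ ψ ∈ s, ψ.Realize (v i) := by
    rw [Filter.eventually_all_finset]
    exact fun ψ hψ => hs hψ
  obtain ⟨i, hi⟩ := this.exists
  exact ⟨M i, inferInstance, inferInstance, hM i, v i, hi⟩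

/-- Amalgamation of many realizations over a common base. -/
theorem Theory.exists_amalgam {B C D J : Type} {M : Type w₁} [L.Structure M] [Nonempty M]
    (hM : M ⊨ T) {N : J → Type w₂} [∀ j, L.Structure (N j)] [∀ j, Nonempty (N j)]
    (v : B → M) (f : J → C → B) (g : ∀ j, C ⊕ D → N j)
    (h : ∀ j, SameType L (fun x => v (f j x)) (fun x => g j (Sum.inl x))) :
    ∃ (K : Theory.ModelType.{u, v, max u v} T) (v' : B → K) (w : J → D → K), SameType L v' v ∧
      ∀ j, SameType L (Sum.elim (fun x => v' (f j x)) (w j)) (g j) := by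
  classical
  let ρ : J → C ⊕ D → B ⊕ (J × D) := fun j =>
    Sum.elim (fun x => Sum.inl (f j x)) (fun d => Sum.inr (j, d))
  obtain ⟨K, z, hz⟩ := Theory.exists_realize_of_finset.{u, v, w₁} (T := T)
    ({χ : L.Formula (B ⊕ (J × D)) | ∃ ψ : L.Formula B, ψ.Realize v ∧ χ = ψ.relabel Sum.inl} ∪
      {χ | ∃ (j : J) (ψ : L.Formula (C ⊕ D)), ψ.Realize (g j) ∧ χ = ψ.relabel (ρ j)}) (by
    intro s hs
    -- The new variables for different `j` are disjoint, so witnesses may be found in `M` separately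
    -- for each `j`. The finitely many conditions on one `j` form an existential statement about the
    -- common base.
    have hex : ∀ j, ∃ c : D → M, ∀ ψ : L.Formula (C ⊕ D), ψ.Realize (g j) →
        ψ.relabel (ρ j) ∈ s → ψ.Realize (Sum.elim (fun x => v (f j x)) c) := by
      intro j
      let Q := {χ : s // ∃ ψ : L.Formula (C ⊕ D), ψ.Realize (g j) ∧ ψ.relabel (ρ j) = χ}
      have : ∀ q : Q, ∃ ψ : L.Formula (C ⊕ D), ψ.Realize (g j) ∧ ψ.relabel (ρ j) = q.1 :=
        fun q => q.2
      choose ψ hψ hψ' using this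
      have h1 := (h j).symm.exists_iff (Q := Q) (κ := D) (ν := C)
        (fun q => (ψ q).relabel Sum.swap) (fun _ x => x)
      obtain ⟨c, hc⟩ := h1.1 ⟨fun d => g j (Sum.inr d), fun q => by
        rw [Formula.realize_relabel]
        convert hψ q using 1
        ext x; rcases x with x | x <;> rfl⟩
      refine ⟨c, fun χ hχ hs' => ?_⟩
      have h2 := hc ⟨⟨_, hs'⟩, χ, hχ, rfl⟩
      rw [Formula.realize_relabel] at h2
      have h3 := hψ' ⟨⟨_, hs'⟩, χ, hχ, rfl⟩
      -- `ρ j` need not be injective, so the preimage chosen for an element of `s` may differ from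
      -- `χ`; the two are compared through their common relabelling.
      have hd : ∀ θ : L.Formula (C ⊕ D), (θ.relabel (ρ j)).Realize
          (Sum.elim v (fun p : J × D => c p.2)) ↔
          θ.Realize (Sum.elim (fun x => v (f j x)) c) := fun θ => by
        rw [Formula.realize_relabel]
        have : Sum.elim v (fun p : J × D => c p.2) ∘ ρ j = Sum.elim (fun x => v (f j x)) c := by
          ext x; rcases x with x | x <;> rfl
        rw [this]
      rw [← hd]
      refine Eq.mp (congrArg (fun θ : L.Formula (B ⊕ (J × D)) => θ.Realize
        (Sum.elim v (fun p : J × D => c p.2))) h3) ((hd _).2 ?_)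
      convert h2 using 1
      ext x; rcases x with x | x <;> rfl
    choose c hc using hex
    refine ⟨M, inferInstance, inferInstance, hM, Sum.elim v (fun p => c p.1 p.2), ?_⟩
    intro χ hχ
    rcases hs hχ with ⟨ψ, hψ, rfl⟩ | ⟨j, ψ, hψ, rfl⟩
    · rw [Formula.realize_relabel]; exact hψ
    · rw [Formula.realize_relabel]
      convert hc j ψ hψ hχ using 1
      ext x; rcases x with x | x <;> rfl)
  refine ⟨K, fun b => z (Sum.inl b), fun j d => z (Sum.inr (j, d)), ?_, fun j => ?_⟩
  · refine (SameType.of_imp fun ψ hψ => ?_).symm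
    have := hz _ (Or.inl ⟨ψ, hψ, rfl⟩)
    rwa [Formula.realize_relabel] at this
  · refine (SameType.of_imp fun ψ hψ => ?_).symm
    have := hz _ (Or.inr ⟨j, ψ, hψ, rfl⟩)
    rw [Formula.realize_relabel] at this
    convert this using 1
    ext x; rcases x with x | x <;> rfl

end Compactness

end FirstOrder.Language

/-! ### Ramsey's theorem by iterated ultrafilter quantifiers. -/

/-- If a property of finite sets of natural numbers can always be extended by arbitrarily large
elements, then it holds along some strictly increasing sequence. -/
theorem exists_strictMono_forall_image_range {I : Finset ℕ → Prop} (h0 : I ∅)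
    (h : ∀ B, I B → ∃ i, (∀ b ∈ B, b < i) ∧ I (insert i B)) :
    ∃ f : ℕ → ℕ, StrictMono f ∧ ∀ k, I ((Finset.range k).image f) := by
  choose! c hc hI using h
  let S : ℕ → {B // I B} := fun k =>
    Nat.rec ⟨∅, h0⟩ (fun _ B => ⟨insert (c B.1) B.1, hI B.1 B.2⟩) k
  have hS : ∀ k, (S (k + 1)).1 = insert (c (S k).1) (S k).1 := fun k => rfl
  have himg : ∀ k, (Finset.range k).image (fun j => c (S j).1) = (S k).1 := by
    intro k
    induction k with
    | zero => rfl
    | succ k ih => rw [Finset.range_add_one, Finset.image_insert, ih, hS]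
  refine ⟨fun k => c (S k).1, strictMono_nat_of_lt_succ fun k => ?_, fun k => ?_⟩
  · refine hc (S (k + 1)).1 (S (k + 1)).2 _ ?_
    rw [hS]; exact Finset.mem_insert_self _ _
  · rw [himg]; exact (S k).2

/-- Iterated quantification with respect to an ultrafilter. -/
def Ultrafilter.iterEventually (U : Ultrafilter ℕ) (Q : Finset ℕ → Prop) : ℕ → Finset ℕ → Prop
  | 0, A => Q A
  | d + 1, A => ∀ᶠ i in (U : Filter ℕ), U.iterEventually Q d (insert i A)

theorem Ultrafilter.iterEventually_not (U : Ultrafilter ℕ) (Q : Finset ℕ → Prop) (d : ℕ)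
    (A : Finset ℕ) (h : ¬ U.iterEventually Q d A) : U.iterEventually (fun A => ¬ Q A) d A := by
  induction d generalizing A with
  | zero => exact h
  | succ d ih =>
    have := Ultrafilter.eventually_not.2 h
    exact this.mono fun i hi => ih _ hi

/-- The invariant for the chosen set `B` is that each `A ⊆ B` with at most `n` elements satisfies
the remaining `n - A.card` quantifiers. Almost every `i` preserves it, since `B` has only finitely
many subsets. -/
theorem Ultrafilter.exists_strictMono_of_iterEventually {Q : Finset ℕ → Prop} {n : ℕ}
    (h : (Filter.hyperfilter ℕ).iterEventually Q n ∅) :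
    ∃ f : ℕ → ℕ, StrictMono f ∧ ∀ A k, A ⊆ (Finset.range k).image f → A.card = n → Q A := by
  obtain ⟨f, hf, hI⟩ := exists_strictMono_forall_image_range
    (I := fun B => ∀ A ⊆ B, A.card ≤ n →
      (Filter.hyperfilter ℕ).iterEventually Q (n - A.card) A) (by
        intro A hA _
        rw [Finset.subset_empty.1 hA]; exact h) (by
    intro B hB
    have h1 : ∀ᶠ i in (Filter.hyperfilter ℕ : Filter ℕ), ∀ A ∈ B.powerset, A.card < n →
        (Filter.hyperfilter ℕ).iterEventually Q (n - A.card - 1) (insert i A) := by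
      rw [Filter.eventually_all_finset]
      intro A hA
      by_cases hc : A.card < n
      · have := hB A (Finset.mem_powerset.1 hA) hc.le
        obtain ⟨d, hd⟩ : ∃ d, n - A.card = d + 1 := ⟨n - A.card - 1, by omega⟩
        rw [hd] at this
        refine Filter.Eventually.mono this fun i hi _ => ?_
        rw [hd]; exact hi
      · exact Filter.Eventually.of_forall fun i h' => absurd h' hc
    have h2 : ∀ᶠ i in (Filter.hyperfilter ℕ : Filter ℕ), ∀ b ∈ B, b < i := by
      rw [Filter.eventually_all_finset]
      intro b _
      exact Filter.Eventually.filter_mono Nat.hyperfilter_le_atTop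
        (Filter.eventually_gt_atTop b)
    obtain ⟨i, hi, hi'⟩ := (h1.and h2).exists
    refine ⟨i, hi', fun A hA hc => ?_⟩
    by_cases hiA : i ∈ A
    · have hlt : (A.erase i).card + 1 = A.card := Finset.card_erase_add_one hiA
      have := hi (A.erase i) (by
        rw [Finset.mem_powerset]
        intro x hx
        rcases Finset.mem_insert.1 (hA (Finset.mem_of_mem_erase hx)) with rfl | hx'
        · exact absurd rfl (Finset.ne_of_mem_erase hx)
        · exact hx') (by omega)
      rw [Finset.insert_erase hiA] at this
      rwa [show n - A.card = n - (A.erase i).card - 1 by omega]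
    · exact hB A (fun x hx => by
        rcases Finset.mem_insert.1 (hA hx) with rfl | hx'
        · exact absurd hx hiA
        · exact hx') hc)
  refine ⟨f, hf, fun A k hA hc => ?_⟩
  have := hI k A hA hc.le
  rwa [hc, Nat.sub_self] at this

/-- Ramsey's theorem for properties of increasing sequences that depend on finitely many terms. -/
theorem exists_strictMono_homogeneous (P : (ℕ → ℕ) → Prop) (n : ℕ)
    (hP : ∀ f g : ℕ → ℕ, (∀ i < n, f i = g i) → (P f ↔ P g)) :
    ∃ f : ℕ → ℕ, StrictMono f ∧ ∀ s : ℕ → ℕ, StrictMono s → (P (f ∘ s) ↔ P f) := by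
  -- An `n`-element set is read as the first `n` terms of a sequence; the value `0` afterwards is
  -- immaterial by `hP`.
  let Q : Finset ℕ → Prop := fun A => ∀ h : A.card = n,
    P (fun i => if hi : i < n then A.orderEmbOfFin h ⟨i, hi⟩ else 0)
  have hQ : ∀ f : ℕ → ℕ, StrictMono f →
      ∃ h : ((Finset.range n).image f).card = n,
        (P (fun i => if hi : i < n then ((Finset.range n).image f).orderEmbOfFin h ⟨i, hi⟩
          else 0) ↔ P f) := by
    intro f hf
    have h : ((Finset.range n).image f).card = n := by
      rw [Finset.card_image_of_injective _ hf.injective, Finset.card_range]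
    refine ⟨h, hP _ _ fun i hi => ?_⟩
    have := Finset.orderEmbOfFin_unique h (f := fun i : Fin n => f i)
      (fun x => Finset.mem_image_of_mem _ (Finset.mem_range.2 x.2))
      (fun x y hxy => hf hxy)
    rw [dif_pos hi, ← this]
  have hsub : ∀ f s : ℕ → ℕ, StrictMono s →
      (Finset.range n).image (f ∘ s) ⊆ (Finset.range (s n)).image f := by
    intro f s hs x hx
    obtain ⟨i, hi, rfl⟩ := Finset.mem_image.1 hx
    exact Finset.mem_image_of_mem _ (Finset.mem_range.2 (hs (Finset.mem_range.1 hi)))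
  by_cases hU : (Filter.hyperfilter ℕ).iterEventually Q n ∅
  · obtain ⟨f, hf, hA⟩ := Ultrafilter.exists_strictMono_of_iterEventually hU
    have key : ∀ s : ℕ → ℕ, StrictMono s → P (f ∘ s) := fun s hs => by
      obtain ⟨h, h'⟩ := hQ (f ∘ s) (hf.comp hs)
      exact h'.1 (hA _ _ (hsub f s hs) h h)
    refine ⟨f, hf, fun s hs => ⟨fun _ => key id strictMono_id, fun _ => key s hs⟩⟩
  · obtain ⟨f, hf, hA⟩ := Ultrafilter.exists_strictMono_of_iterEventually
      (Ultrafilter.iterEventually_not _ _ _ _ hU)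
    have key : ∀ s : ℕ → ℕ, StrictMono s → ¬ P (f ∘ s) := fun s hs => by
      obtain ⟨h, h'⟩ := hQ (f ∘ s) (hf.comp hs)
      exact fun hp => hA _ _ (hsub f s hs) h fun _ => h'.2 hp
    exact ⟨f, hf, fun s hs => ⟨fun hp => absurd hp (key s hs),
      fun hp => absurd hp (key id strictMono_id)⟩⟩

theorem exists_strictMono_homogeneous_finset {Q : Type*} (F : Finset Q)
    (P : Q → (ℕ → ℕ) → Prop)
    (hP : ∀ q, ∃ n, ∀ f g : ℕ → ℕ, (∀ i < n, f i = g i) → (P q f ↔ P q g)) :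
    ∃ f : ℕ → ℕ, StrictMono f ∧ ∀ q ∈ F, ∀ s : ℕ → ℕ, StrictMono s → (P q (f ∘ s) ↔ P q f) := by
  classical
  induction F using Finset.induction_on with
  | empty => exact ⟨id, strictMono_id, by simp⟩
  | insert q F _ ih =>
    obtain ⟨f, hf, h⟩ := ih
    obtain ⟨n, hn⟩ := hP q
    obtain ⟨g, hg, h'⟩ := exists_strictMono_homogeneous (fun s => P q (f ∘ s)) n
      (fun s s' hs => hn _ _ fun i hi => by simp [hs i hi])
    refine ⟨f ∘ g, hf.comp hg, fun q' hq' s hs => ?_⟩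
    rcases Finset.mem_insert.1 hq' with rfl | hq'
    · exact h' s hs
    · exact (h q' hq' (g ∘ s) (hg.comp hs)).trans (h q' hq' g hg).symm

/-! ### Extraction of indiscernibles in several directions. -/

/-- An action of the maps `ℕ → ℕ`, one for each direction `d ∈ D`, on a set of variables, such that
each variable only feels finitely many values. -/
structure ShiftAction (D V : Type) where
  /-- The action. -/
  act : (D → ℕ → ℕ) → V → V
  act_id : ∀ x, act (fun _ => id) x = x
  act_comp : ∀ σ τ x, act (fun d => σ d ∘ τ d) x = act σ (act τ x)
  act_supp : ∀ x, ∃ n, ∀ σ τ : D → ℕ → ℕ, (∀ d, ∀ i < n, σ d i = τ d i) → act σ x = act τ x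

theorem ShiftAction.exists_supp {D V : Type} (A : ShiftAction D V) (F : Finset V) :
    ∃ n, ∀ x ∈ F, ∀ σ τ : D → ℕ → ℕ, (∀ d, ∀ i < n, σ d i = τ d i) → A.act σ x = A.act τ x := by
  choose n hn using A.act_supp
  exact ⟨F.sup n, fun x hx σ τ h => hn x σ τ fun d i hi =>
    h d i (hi.trans_le (Finset.le_sup (f := n) hx))⟩

namespace FirstOrder.Language

universe w₁ w₂ w₃

variable {L : Language.{u, v}} {T : L.Theory}

section Shift

variable {D V : Type} [DecidableEq D]

/-- Finitely many instances of invariance concern finitely many formulas, and Ramsey's theorem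
provides a shift of `v` satisfying them. Compactness does the rest. What held for all shifts of `v`
is retained. -/
theorem Theory.exists_shift_invariant_direction (A : ShiftAction D V) {M : Type w₁} [L.Structure M]
    [Nonempty M] (hM : M ⊨ T) (v : V → M) (d : D) :
    ∃ (N : Theory.ModelType.{u, v, max u v} T) (v' : V → N),
      (∀ ψ : L.Formula V, (∀ s, StrictMono s →
        ψ.Realize (fun x => v (A.act (Function.update (fun _ => id) d s) x))) → ψ.Realize v') ∧
      ∀ s, StrictMono s →
        SameType L (fun x => v' (A.act (Function.update (fun _ => id) d s) x)) v' := by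
  classical
  let a : (ℕ → ℕ) → V → V := fun s x => A.act (Function.update (fun _ => id) d s) x
  have ha : ∀ s t x, a (s ∘ t) x = a s (a t x) := by
    intro s t x
    simp only [a]
    rw [← A.act_comp]
    congr 1
    funext d'
    by_cases h : d' = d
    · subst h; simp
    · simp [h]
  have hsupp : ∀ ψ : L.Formula V, ∃ n, ∀ f g : ℕ → ℕ, (∀ i < n, f i = g i) →
      (ψ.Realize (fun x => v (a f x)) ↔ ψ.Realize (fun x => v (a g x))) := by
    intro ψ
    obtain ⟨n, hn⟩ := A.exists_supp (BoundedFormula.freeVarFinset ψ)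
    refine ⟨n, fun f g h => Formula.realize_congr_of_freeVar _ fun x hx => ?_⟩
    simp only [a]
    rw [hn x hx]
    intro d' i hi
    by_cases hd : d' = d
    · subst hd; simp [h i hi]
    · simp [hd]
  obtain ⟨N, v', hv'⟩ := Theory.exists_realize_of_finset (T := T)
    ({ψ : L.Formula V | ∀ s, StrictMono s → ψ.Realize (fun x => v (a s x))} ∪
      {χ | ∃ s, StrictMono s ∧ ∃ ψ : L.Formula V, χ = (ψ.relabel (a s)).iff ψ}) (by
    intro S hS
    have hfor : ∀ χ : L.Formula V, ∃ (s : ℕ → ℕ) (ψ : L.Formula V), StrictMono s ∧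
        ((∃ s, StrictMono s ∧ ∃ ψ : L.Formula V, χ = (ψ.relabel (a s)).iff ψ) →
          χ = (ψ.relabel (a s)).iff ψ) := by
      intro χ
      by_cases h : ∃ s, StrictMono s ∧ ∃ ψ : L.Formula V, χ = (ψ.relabel (a s)).iff ψ
      · obtain ⟨s, hs, ψ, h⟩ := h
        exact ⟨s, ψ, hs, fun _ => h⟩
      · exact ⟨id, χ, strictMono_id, fun h' => absurd h' h⟩
    choose s ψ hs hψ using hfor
    obtain ⟨f, hf, hhom⟩ := exists_strictMono_homogeneous_finset S
      (fun χ f => (ψ χ).Realize (fun x => v (a f x))) (fun χ => hsupp (ψ χ))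
    refine ⟨M, inferInstance, inferInstance, hM, fun x => v (a f x), fun χ hχ => ?_⟩
    rcases hS hχ with h | h
    · exact h f hf
    · rw [hψ χ h, Formula.realize_iff, Formula.realize_relabel]
      have := hhom χ hχ (s χ) (hs χ)
      simp only [ha] at this
      exact this)
  refine ⟨N, v', fun ψ hψ => hv' _ (Or.inl hψ), fun s hs ψ => ?_⟩
  have := hv' _ (Or.inr ⟨s, hs, ψ, rfl⟩)
  rw [Formula.realize_iff, Formula.realize_relabel] at this
  exact this

/-- Extraction of an assignment that is indiscernible in all directions. -/
theorem Theory.exists_shift_invariant [Fintype D] (A : ShiftAction D V) {M : Type w₁}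
    [L.Structure M] [Nonempty M] (hM : M ⊨ T) (v : V → M) :
    ∃ (N : Theory.ModelType.{u, v, max u v} T) (v' : V → N),
      (∀ ψ : L.Formula V, (∀ σ : D → ℕ → ℕ, (∀ d, StrictMono (σ d)) →
        ψ.Realize (fun x => v (A.act σ x))) → ψ.Realize v') ∧
      ∀ σ : D → ℕ → ℕ, (∀ d, StrictMono (σ d)) → SameType L (fun x => v' (A.act σ x)) v' := by
  suffices H : ∀ F : Finset D, ∃ (N : Theory.ModelType.{u, v, max u v} T) (v' : V → N),
      (∀ ψ : L.Formula V, (∀ σ : D → ℕ → ℕ, (∀ d, StrictMono (σ d)) →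
        ψ.Realize (fun x => v (A.act σ x))) → ψ.Realize v') ∧
      ∀ σ : D → ℕ → ℕ, (∀ d, StrictMono (σ d)) → (∀ d ∉ F, σ d = id) →
        SameType L (fun x => v' (A.act σ x)) v' by
    obtain ⟨N, v', h1, h2⟩ := H Finset.univ
    exact ⟨N, v', h1, fun σ hσ => h2 σ hσ (by simp)⟩
  intro F
  induction F using Finset.induction_on with
  | empty =>
    obtain ⟨N, v', h⟩ := Theory.exists_limit (T := T) (fun _ => hM) (fun _ => v)
    refine ⟨N, v', fun ψ hψ => h ψ (Filter.Eventually.of_forall fun _ => ?_), fun σ _ hσ' => ?_⟩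
    · have := hψ (fun _ => id) (fun _ => strictMono_id)
      simpa only [A.act_id] using this
    · have : σ = fun _ => id := funext fun d => hσ' d (by simp)
      subst this
      simp only [A.act_id]
      exact SameType.refl _
  | insert d F hd ih =>
    obtain ⟨N, v', h1, h2⟩ := ih
    obtain ⟨K, z, hz1, hz2⟩ := Theory.exists_shift_invariant_direction A N.is_model v' d
    have hu : ∀ s : ℕ → ℕ, StrictMono s → ∀ d',
        StrictMono (Function.update (fun _ => id) d s d') := by
      intro s hs d'
      by_cases h : d' = d
      · subst h; simpa using hs
      · simpa [h] using strictMono_id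
    -- Shifts in different directions commute, so invariance in the directions of `F` holds for
    -- every shift of `v'` along `d` and therefore survives the new extraction.
    have hzF : ∀ σ : D → ℕ → ℕ, (∀ d, StrictMono (σ d)) → (∀ d ∉ F, σ d = id) →
        SameType L (fun x => z (A.act σ x)) z := by
      intro σ hσ hσF ψ
      have := hz1 ((ψ.relabel (A.act σ)).iff ψ) (fun s hs => by
        rw [Formula.realize_iff, Formula.realize_relabel]
        have h3 := (h2 σ hσ hσF).comp (A.act (Function.update (fun _ => id) d s)) ψ
        convert h3 using 2
        funext x
        simp only [Function.comp]
        rw [← A.act_comp, ← A.act_comp]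
        congr 2
        funext d'
        by_cases h : d' = d
        · subst h; simp [hσF d' hd]
        · simp [h])
      rw [Formula.realize_iff, Formula.realize_relabel] at this
      exact this
    refine ⟨K, z, fun ψ hψ => hz1 ψ fun s hs => ?_, fun σ hσ hσF => ?_⟩
    · have := h1 (ψ.relabel (A.act (Function.update (fun _ => id) d s))) (fun σ hσ => by
        rw [Formula.realize_relabel]
        have := hψ _ (fun d' => (hσ d').comp (hu s hs d'))
        simp only [A.act_comp] at this
        exact this)
      rwa [Formula.realize_relabel] at this
    · have e1 : ∀ x, A.act σ x = A.act (Function.update (fun _ => id) d (σ d))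
          (A.act (Function.update σ d id) x) := by
        intro x
        rw [← A.act_comp]
        congr 1
        funext d'
        by_cases h : d' = d
        · subst h; simp
        · simp [h]
      simp only [e1]
      refine ((hz2 (σ d) (hσ d)).comp (A.act (Function.update σ d id))).trans ?_
      refine hzF _ (fun d' => ?_) (fun d' hd' => ?_)
      · by_cases h : d' = d
        · subst h; simpa using strictMono_id
        · simpa [h] using hσ d'
      · by_cases h : d' = d
        · subst h; simp
        · simp only [Function.update_of_ne h]
          exact hσF d' (by simp [h, hd'])

end Shift

end FirstOrder.Language

/-- A finite increasing sequence of natural numbers extends to an infinite one. -/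
theorem exists_strictMono_extend {k : ℕ} (o : Fin k → ℕ) (ho : StrictMono o) :
    ∃ s : ℕ → ℕ, StrictMono s ∧ ∀ i : Fin k, s i = o i := by
  let B := Finset.univ.sup o
  refine ⟨fun x => if h : x < k then o ⟨x, h⟩ else B + 1 + x, fun x y hxy => ?_, fun i => by simp⟩
  by_cases hy : y < k
  · have hx : x < k := hxy.trans hy
    simp only [hx, hy, dif_pos]
    exact ho hxy
  · by_cases hx : x < k
    · simp only [hx, hy, dif_pos, dif_neg, not_false_iff]
      have : o ⟨x, hx⟩ ≤ B := Finset.le_sup (f := o) (Finset.mem_univ _)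
      omega
    · simp only [hx, hy, dif_neg, not_false_iff]
      omega

namespace FirstOrder.Language

universe w₁ w₂ w₃

variable {L : Language.{u, v}} {T : L.Theory}

/-! ### Ehrenfeucht–Mostowski types. -/

section EMLike

variable {ν : Type*} {M₀ : Type w₁} [L.Structure M₀] {M : Type w₂} [L.Structure M]
  {N : Type w₃} [L.Structure N]

/-- All increasing tuples of the family `c` have the type of an initial segment of `a`. -/
def EMLike (L : Language.{u, v}) {ν : Type*} {M₀ : Type w₁} [L.Structure M₀] (a : ℕ → ν → M₀)
    {O : Type*} [Preorder O] {M : Type w₂} [L.Structure M] (c : O → ν → M) : Prop :=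
  ∀ (k : ℕ) (ψ : L.Formula (Fin k × ν)) (o : Fin k → O), StrictMono o →
    (ψ.Realize (fun p => c (o p.1) p.2) ↔ ψ.Realize (fun p => a p.1 p.2))

/-- Two families with the same Ehrenfeucht–Mostowski type agree on index patterns of the same order
type. -/
theorem EMLike.sameType {a : ℕ → ν → M₀} {O O' X : Type*} [LinearOrder O] [LinearOrder O']
    {c : O → ν → M} {c' : O' → ν → N} (hc : EMLike L a c) (hc' : EMLike L a c') (f : X → O)
    (f' : X → O') (h : ∀ x y, f x < f y ↔ f' x < f' y) :
    SameType L (fun p : X × ν => c (f p.1) p.2) (fun p : X × ν => c' (f' p.1) p.2) := by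
  classical
  intro ψ
  have hinj : ∀ x y, f x = f y → f' x = f' y := fun x y hxy => by
    refine le_antisymm (not_lt.1 fun h' => ?_) (not_lt.1 fun h' => ?_)
    · exact absurd ((h _ _).2 h') (by rw [hxy]; exact lt_irrefl _)
    · exact absurd ((h _ _).2 h') (by rw [hxy]; exact lt_irrefl _)
  let S := BoundedFormula.freeVarFinset ψ
  -- Only the indices occurring in `ψ` matter. Enumerated increasingly, they turn `ψ` into a formula
  -- about an increasing tuple, to which both hypotheses apply.
  let F : Finset O := S.image fun p => f p.1
  let e : Fin F.card ≃o F := F.orderIsoOfFin rfl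
  have hch : ∀ i : Fin F.card, ∃ x : X, f x = e i := fun i => by
    obtain ⟨p, -, hp⟩ := Finset.mem_image.1 (e i).2
    exact ⟨p.1, hp⟩
  choose x hx using hch
  let g : S → Fin F.card × ν := fun p => (e.symm ⟨f p.1.1, Finset.mem_image_of_mem _ p.2⟩, p.1.2)
  have hxg : ∀ p : S, f (x (g p).1) = f p.1.1 := fun p => by
    rw [hx]
    simp [g]
  have h1 := hc _ (BoundedFormula.restrictFreeVar ψ g) (fun i => f (x i)) (fun i j hij => by
    simp only [hx]
    exact e.strictMono hij)
  have h2 := hc' _ (BoundedFormula.restrictFreeVar ψ g) (fun i => f' (x i)) (fun i j hij => by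
    rw [← h, hx, hx]
    exact e.strictMono hij)
  have h3 : Formula.Realize (BoundedFormula.restrictFreeVar ψ g)
      (fun p => c (f (x p.1)) p.2) ↔ ψ.Realize (fun p : X × ν => c (f p.1) p.2) :=
    BoundedFormula.realize_restrictFreeVar _ fun p => by
      show c (f (x (g p).1)) _ = _
      rw [hxg]
  have h4 : Formula.Realize (BoundedFormula.restrictFreeVar ψ g)
      (fun p => c' (f' (x p.1)) p.2) ↔ ψ.Realize (fun p : X × ν => c' (f' p.1) p.2) :=
    BoundedFormula.realize_restrictFreeVar _ fun p => by
      show c' (f' (x (g p).1)) _ = _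
      rw [hinj _ _ (hxg p)]
  rw [← h3, ← h4, h1, h2]

theorem EMLike.comp {a : ℕ → ν → M₀} {O O' : Type*} [Preorder O] [Preorder O'] {c : O → ν → M}
    (hc : EMLike L a c) {f : O' → O} (hf : StrictMono f) : EMLike L a (fun i => c (f i)) :=
  fun k ψ o ho => hc k ψ (f ∘ o) (hf.comp ho)

theorem EMLike.self {a : ℕ → ν → M₀} {c : ℕ → ν → M} (hc : EMLike L a c) : EMLike L c c :=
  fun k ψ o ho => (hc k ψ o ho).trans (hc k ψ (fun i => i) fun _ _ h => h).symm

theorem EMLike.of_sameType {a : ℕ → ν → M₀} {O : Type*} [Preorder O] {c : O → ν → M}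
    {c' : O → ν → N} (hc : EMLike L a c)
    (h : SameType L (fun p : O × ν => c' p.1 p.2) (fun p : O × ν => c p.1 p.2)) :
    EMLike L a c' := fun k ψ o ho =>
  ((h.comp (fun p : Fin k × ν => (o p.1, p.2))) ψ).trans (hc k ψ o ho)

theorem EMLike.of_shift {c : ℕ → ν → M} (h : ∀ s : ℕ → ℕ, StrictMono s →
    SameType L (fun p : ℕ × ν => c (s p.1) p.2) (fun p : ℕ × ν => c p.1 p.2)) : EMLike L c c := by
  intro k ψ o ho
  obtain ⟨s, hs, hso⟩ := exists_strictMono_extend o ho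
  have := (h s hs).comp (fun p : Fin k × ν => ((p.1 : ℕ), p.2)) ψ
  simpa only [hso] using this

theorem IndiscernibleSeq.emLike {n : ℕ} {a : ℕ → Fin n → M} (h : IndiscernibleSeq L a) :
    EMLike L a a := fun k ψ o ho => h k ψ o (fun i => i) ho fun _ _ h => h

theorem EMLike.indiscernibleSeq {a : ℕ → ν → M} (h : EMLike L a a) {n : ℕ} (e : Fin n → ν) :
    IndiscernibleSeq L (fun i x => a i (e x)) := by
  intro k ψ i j hi hj
  have h1 := h k (ψ.relabel (Prod.map id e)) i hi
  have h2 := h k (ψ.relabel (Prod.map id e)) j hj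
  rw [Formula.realize_relabel] at h1 h2
  exact h1.trans h2.symm

end EMLike

/-- Increasing maps acting on the sequence index of a family of sequences. -/
def seqShift (γ δ : Type) : ShiftAction Unit (γ ⊕ (ℕ × δ)) where
  act σ := Sum.map id (Prod.map (σ ()) id)
  act_id x := by rcases x with x | ⟨i, x⟩ <;> rfl
  act_comp σ τ x := by rcases x with x | ⟨i, x⟩ <;> rfl
  act_supp x := by
    rcases x with x | ⟨i, x⟩
    · exact ⟨0, fun _ _ _ => rfl⟩
    · exact ⟨i + 1, fun σ τ h => by simp [h () i (Nat.lt_succ_self i)]⟩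

/-! ### Usable forms of resilience and of NTP₂. -/

section Resilience

variable {ν κ : Type} [Finite ν] [Finite κ]

/-- Thinning and then inserting gives a subsequence of an insertion into the original sequence.
Extraction therefore preserves the insertion hypothesis of resilience. -/
theorem insertAfter_comp {X : Type*} {s : ℕ → ℕ} (hs : StrictMono s) (a : ℕ → X) (k : ℕ) (c : X) :
    ∃ t : ℕ → ℕ, StrictMono t ∧
      insertAfter (fun i => a (s i)) k c = fun i => insertAfter a (s k) c (t i) := by
  -- Past the inserted term, which sits at place `s k + 1`, all indices move up by one.
  refine ⟨fun i => if i ≤ k then s i else if i = k + 1 then s k + 1 else s (i - 1) + 1,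
    strictMono_nat_of_lt_succ fun i => ?_, ?_⟩
  · have h1 := hs (Nat.lt_succ_self i)
    rcases lt_trichotomy i k with h | h | h
    · simp only [show i ≤ k by omega, show i + 1 ≤ k by omega, if_true]; exact h1
    · subst h; simp
    · have e1 : ¬ i ≤ k := by omega
      have e2 : ¬ i + 1 ≤ k := by omega
      have e3 : ¬ i + 1 = k + 1 := by omega
      simp only [e1, e2, e3, if_false, Nat.add_sub_cancel]
      by_cases h4 : i = k + 1
      · simp only [h4, if_true]
        have := hs (show k < k + 1 by omega)
        omega
      · simp only [h4, if_false]
        have := hs (show i - 1 < i by omega)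
        omega
  · funext i
    unfold insertAfter
    by_cases h1 : i ≤ k
    · simp [h1, hs.le_iff_le.2 h1]
    · by_cases h2 : i = k + 1
      · simp [h2]
      · have h3 : s k < s (i - 1) := hs (by omega)
        simp only [h1, h2, if_false, Nat.add_sub_cancel]
        rw [if_neg (by omega), if_neg (by omega)]

/-- The sequence `C` need not be indiscernible, so resilience is applied to an indiscernible
sequence of pairs extracted from `(A, C)`. If no `n`-term subsequence of `C` were consistent, this
would hold for all shifts and so pass to the extracted sequence. -/
theorem Theory.IsOmegaResilient.exists_consistent_subsequence (hres : T.IsOmegaResilient)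
    (M : Theory.ModelType.{u, v, max u v} T) (A C : ℕ → ν → M)
    (hins : ∀ k, EMLike L (insertAfter A k (C k)) (insertAfter A k (C k)))
    (ψ : L.Formula (κ ⊕ ν))
    (hcons : ∀ n, ∃ c : κ → M, ∀ i : Fin n, ψ.Realize (Sum.elim c (A i))) (n : ℕ) :
    ∃ s : ℕ → ℕ, StrictMono s ∧ ∃ c : κ → M, ∀ i : Fin n, ψ.Realize (Sum.elim c (C (s i))) := by
  obtain ⟨N, z, hz1, hz2⟩ := Theory.exists_shift_invariant (seqShift Empty (ν ⊕ ν)) M.is_model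
    (Sum.elim Empty.elim fun p => Sum.elim (A p.1) (C p.1) p.2)
  let A' : ℕ → ν → N := fun i x => z (Sum.inr (i, Sum.inl x))
  let C' : ℕ → ν → N := fun i x => z (Sum.inr (i, Sum.inr x))
  have hA' : EMLike L A' A' := EMLike.of_shift fun s hs =>
    (hz2 (fun _ => s) fun _ => hs).comp (fun p : ℕ × ν => Sum.inr (p.1, Sum.inl p.2))
  have hC' : EMLike L C' C' := EMLike.of_shift fun s hs =>
    (hz2 (fun _ => s) fun _ => hs).comp (fun p : ℕ × ν => Sum.inr (p.1, Sum.inr p.2))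
  have hins' : ∀ k, EMLike L (insertAfter A' k (C' k)) (insertAfter A' k (C' k)) := by
    intro k
    refine EMLike.of_shift fun s hs => ?_
    let g : ℕ → ν → Empty ⊕ (ℕ × (ν ⊕ ν)) :=
      insertAfter (fun i x => Sum.inr (i, Sum.inl x)) k (fun x => Sum.inr (k, Sum.inr x))
    have hg : ∀ {K : Type (max u v)} (y : Empty ⊕ (ℕ × (ν ⊕ ν)) → K) i x, y (g i x) =
        insertAfter (fun i x => y (Sum.inr (i, Sum.inl x))) k
          (fun x => y (Sum.inr (k, Sum.inr x))) i x := by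
      intro K y i x
      simp only [g, insertAfter]
      split_ifs <;> rfl
    intro θ
    have := hz1 ((θ.relabel fun p : ℕ × ν => g (s p.1) p.2).iff (θ.relabel fun p => g p.1 p.2))
      (fun σ hσ => by
        rw [Formula.realize_iff, Formula.realize_relabel, Formula.realize_relabel]
        simp only [Function.comp_def]
        rw [show (fun p : ℕ × ν => Sum.elim Empty.elim (fun p : ℕ × (ν ⊕ ν) =>
            Sum.elim (A p.1) (C p.1) p.2) ((seqShift Empty (ν ⊕ ν)).act σ (g (s p.1) p.2))) = _
          from funext fun p => hg (fun q => Sum.elim Empty.elim (fun p : ℕ × (ν ⊕ ν) =>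
            Sum.elim (A p.1) (C p.1) p.2) ((seqShift Empty (ν ⊕ ν)).act σ q)) (s p.1) p.2]
        rw [show (fun p : ℕ × ν => Sum.elim Empty.elim (fun p : ℕ × (ν ⊕ ν) =>
            Sum.elim (A p.1) (C p.1) p.2) ((seqShift Empty (ν ⊕ ν)).act σ (g p.1 p.2))) = _
          from funext fun p => hg (fun q => Sum.elim Empty.elim (fun p : ℕ × (ν ⊕ ν) =>
            Sum.elim (A p.1) (C p.1) p.2) ((seqShift Empty (ν ⊕ ν)).act σ q)) p.1 p.2]
        obtain ⟨t, ht, hte⟩ := insertAfter_comp (hσ ()) A k (C (σ () k))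
        have e : ∀ i x, insertAfter (fun i x => Sum.elim Empty.elim (fun p : ℕ × (ν ⊕ ν) =>
            Sum.elim (A p.1) (C p.1) p.2) ((seqShift Empty (ν ⊕ ν)).act σ
            (Sum.inr (i, Sum.inl x)))) k (fun x => Sum.elim Empty.elim (fun p : ℕ × (ν ⊕ ν) =>
            Sum.elim (A p.1) (C p.1) p.2) ((seqShift Empty (ν ⊕ ν)).act σ
            (Sum.inr (k, Sum.inr x)))) i x =
            insertAfter A (σ () k) (C (σ () k)) (t i) x := fun i x => congrFun (congrFun hte i) x
        simp only [e]
        have hpat := (hins (σ () k)).sameType (hins (σ () k)) (X := ℕ) (fun i => t (s i)) t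
          (fun x y => by rw [ht.lt_iff_lt, ht.lt_iff_lt, hs.lt_iff_lt])
        exact hpat θ)
    rw [Formula.realize_iff, Formula.realize_relabel, Formula.realize_relabel] at this
    simp only [Function.comp_def, hg z] at this
    exact this
  have hconsA' : ∀ n, ∃ c : κ → N, ∀ i : Fin n, ψ.Realize (Sum.elim c (A' i)) := by
    intro n
    have := hz1 (consFormula (fun _ : Fin n => ψ) fun i x => Sum.inr ((i : ℕ), Sum.inl x))
      (fun σ hσ => by
        rw [realize_consFormula]
        obtain ⟨c, hc⟩ := hcons (σ () n)
        exact ⟨c, fun q => hc ⟨σ () q, hσ () q.2⟩⟩)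
    rwa [realize_consFormula] at this
  obtain ⟨m, ⟨e⟩⟩ := Finite.exists_equiv_fin ν
  obtain ⟨m', ⟨e'⟩⟩ := Finite.exists_equiv_fin κ
  have hfam := hres N m (fun i x => A' i (e.symm x)) (fun i x => C' i (e.symm x))
    (hA'.indiscernibleSeq e.symm) (hC'.indiscernibleSeq e.symm) (fun k => by
      have := (hins' k).indiscernibleSeq e.symm
      convert this using 1
      funext i x
      simp only [insertAfter]
      split_ifs <;> rfl) m' (ψ.relabel (Sum.map e' e)) (fun s => by
      obtain ⟨c, hc⟩ := hconsA' (s.sup id + 1)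
      refine ⟨fun x => c (e'.symm x), fun i hi => ?_⟩
      rw [Formula.realize_relabel]
      convert hc ⟨i, Nat.lt_succ_of_le (Finset.le_sup (f := id) hi)⟩ using 1
      funext x
      rcases x with x | x <;> simp)
  have hC2 : ∃ c : κ → N, ∀ i : Fin n, ψ.Realize (Sum.elim c (C' i)) := by
    obtain ⟨c, hc⟩ := hfam (Finset.range n)
    refine ⟨fun x => c (e' x), fun i => ?_⟩
    have := hc i (Finset.mem_range.2 i.2)
    rw [Formula.realize_relabel] at this
    convert this using 1
    funext x
    rcases x with x | x <;> simp
  by_contra hcon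
  push Not at hcon
  have := hz1 (consFormula (fun _ : Fin n => ψ) fun i x => Sum.inr ((i : ℕ), Sum.inr x)).not
    (fun σ hσ => by
      rw [Formula.realize_not, realize_consFormula]
      rintro ⟨c, hc⟩
      obtain ⟨i, hi⟩ := hcon (σ ()) (hσ ()) c
      exact hi (hc i))
  rw [Formula.realize_not, realize_consFormula] at this
  exact this hC2

/-- A finitary form of `NTP₂`. -/
theorem Theory.IsNTP₂.exists_bound (hntp : T.IsNTP₂) (ψ : L.Formula (κ ⊕ ν)) (n : ℕ) :
    ∃ K, ∀ (M : Theory.ModelType.{u, v, max u v} T) (d : ℕ → ℕ → ν → M),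
      (∀ η : ℕ → ℕ, (∀ i, η i < K) →
        ∃ c : κ → M, ∀ i < K, ψ.Realize (Sum.elim c (d i (η i)))) →
      ∃ i < K, ∃ S ⊆ Finset.range K, S.card = n ∧
        ∃ c : κ → M, ∀ j ∈ S, ψ.Realize (Sum.elim c (d i j)) := by
  -- Counterexamples for all `K` have a limit, an infinite array with consistent paths and
  -- `n`-inconsistent rows.
  by_contra hcon
  push Not at hcon
  choose M d hd hrow using hcon
  obtain ⟨N, z, hz⟩ := Theory.exists_limit (T := T) (fun i => (M i).is_model)
    (fun K (p : ℕ × ℕ × ν) => d K p.1 p.2.1 p.2.2)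
  obtain ⟨m, ⟨e⟩⟩ := Finite.exists_equiv_fin ν
  obtain ⟨m', ⟨e'⟩⟩ := Finite.exists_equiv_fin κ
  refine hntp m' m (ψ.relabel (Sum.map e' e)) ⟨N, fun i j x => z (i, j, e.symm x), n, ?_, ?_⟩
  · intro η s
    have := hz (consFormula (fun _ : s => ψ) fun i x => (i.1, η i.1, x)) (by
      filter_upwards [Filter.eventually_gt_atTop (s.sup id), Filter.eventually_gt_atTop (s.sup η)]
        with K h1 h2
      rw [realize_consFormula]
      obtain ⟨c, hc⟩ := hd K (fun i => if η i < K then η i else 0) (fun i => by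
        split_ifs <;> omega)
      refine ⟨c, fun q => ?_⟩
      have := hc q.1 ((Finset.le_sup (f := id) q.2).trans_lt h1)
      rwa [if_pos ((Finset.le_sup (f := η) q.2).trans_lt h2)] at this)
    rw [realize_consFormula] at this
    obtain ⟨c, hc⟩ := this
    refine ⟨fun x => c (e'.symm x), fun i hi => ?_⟩
    rw [Formula.realize_relabel]
    convert hc ⟨i, hi⟩ using 1
    funext x
    rcases x with x | x <;> simp
  · rintro i s hs ⟨c, hc⟩
    have := hz (consFormula (fun _ : s => ψ) fun j x => (i, j.1, x)).not (by
      filter_upwards [Filter.eventually_gt_atTop (s.sup id), Filter.eventually_gt_atTop i]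
        with K h1 h2
      rw [Formula.realize_not, realize_consFormula]
      rintro ⟨c, hc⟩
      obtain ⟨j, hj, hj'⟩ := hrow K i h2 s (fun x hx => Finset.mem_range.2
        ((Finset.le_sup (f := id) hx).trans_lt h1)) hs c
      exact hj' (hc ⟨j, hj⟩))
    rw [Formula.realize_not, realize_consFormula] at this
    refine this ⟨fun x => c (e' x), fun q => ?_⟩
    have := hc q.1 q.2
    rw [Formula.realize_relabel] at this
    convert this using 1
    funext x
    rcases x with x | x <;> simp

end Resilience

/-! ### From the diagonal of an array to its first row. -/

section Array

variable {ν κ : Type} [Finite ν] [Finite κ] {t : ℕ}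

/-- The indices `(i, l)` with `i < n` such that the coordinate `l r` lies in the `i`-th interval of
length `N` for `r < s`, and is `i` for the other `r`. -/
def spreadBox (t s n N : ℕ) : Set (ℕ × (Fin t → ℕ)) :=
  {q | q.1 < n ∧ ∀ r : Fin t,
    if r.val < s then N * q.1 ≤ q.2 r ∧ q.2 r < N * q.1 + N else q.2 r = q.1}

theorem spreadBox_finite (t s n N : ℕ) : (spreadBox t s n N).Finite := by
  refine Set.Finite.subset ((Set.finite_Iio n).prod (Set.Finite.pi fun _ : Fin t =>
    Set.finite_Iio (N * n + n))) fun q hq => ?_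
  refine ⟨hq.1, fun r _ => ?_⟩
  have h1 := hq.1
  have h2 := hq.2 r
  have h3 : N * q.1 + N ≤ N * n := by
    have : N * (q.1 + 1) ≤ N * n := Nat.mul_le_mul_left N h1
    rwa [Nat.mul_add, Nat.mul_one] at this
  show q.2 r < N * n + n
  split_ifs at h2 <;> omega

theorem strictMono_block {K : ℕ} (η : ℕ → ℕ) (g : ℕ → ℕ) (hg : Monotone g) (hη : ∀ i, η i < K)
    (h : ∀ i j, i < j → g i = g j → η i < η j) : StrictMono fun i => K * g i + η i := by
  intro i j hij
  rcases (hg hij.le).lt_or_eq with h1 | h1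
  · have : K * (g i + 1) ≤ K * g j := Nat.mul_le_mul_left K h1
    have := hη i
    show K * g i + η i < K * g j + η j
    rw [Nat.mul_add, Nat.mul_one] at *
    omega
  · have := h i j hij h1
    show K * g i + η i < K * g j + η j
    rw [h1]; omega

/-- In an `NTP₂` theory, if an array is indiscernible with respect to increasing maps in the
direction of its rows and in each of the `t` directions of its columns, and the formulas on the
diagonal are consistent, then so are all formulas of the first row. -/
theorem Theory.IsNTP₂.row_consistent (hntp : T.IsNTP₂) (M : Theory.ModelType.{u, v, max u v} T)
    (e : ℕ → (Fin t → ℕ) → ν → M)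
    (hinv : ∀ (s₀ : ℕ → ℕ) (s : Fin t → ℕ → ℕ), StrictMono s₀ → (∀ r, StrictMono (s r)) →
      SameType L (fun p : ℕ × (Fin t → ℕ) × ν => e (s₀ p.1) (fun r => s r (p.2.1 r)) p.2.2)
        (fun p => e p.1 p.2.1 p.2.2))
    (ψ : L.Formula (κ ⊕ ν))
    (hdiag : ∀ n, ∃ c : κ → M, ∀ i : Fin n, ψ.Realize (Sum.elim c (e i fun _ => i))) (N : ℕ) :
    ∃ c : κ → M, ∀ l : Fin t → ℕ, (∀ r, l r < N) → ψ.Realize (Sum.elim c (e 0 l)) := by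
  have transfer : ∀ (F : Set (ℕ × (Fin t → ℕ))), F.Finite → ∀ (s₀ : ℕ → ℕ) (s : Fin t → ℕ → ℕ),
      StrictMono s₀ → (∀ r, StrictMono (s r)) →
      ((∃ c : κ → M, ∀ q ∈ F, ψ.Realize (Sum.elim c (e (s₀ q.1) (fun r => s r (q.2 r))))) ↔
        ∃ c : κ → M, ∀ q ∈ F, ψ.Realize (Sum.elim c (e q.1 q.2))) := by
    intro F hF s₀ s hs₀ hs
    have : Finite F := hF
    have := (hinv s₀ s hs₀ hs).exists_iff (Q := F) (fun _ => ψ) (fun q x => (q.1.1, q.1.2, x))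
    simpa only [Subtype.forall] using this
  -- One coordinate is spread at a time: `s = 0` is the diagonal, while `s = t` and `n = 1` gives
  -- every `l` with values below `N`. The number `n` of places is arbitrary because each step spends
  -- many places to secure `n` of them.
  suffices H : ∀ N, 0 < N → ∀ s ≤ t, ∀ n, ∃ c : κ → M, ∀ q ∈ spreadBox t s n N,
      ψ.Realize (Sum.elim c (e q.1 q.2)) by
    obtain ⟨c, hc⟩ := H (N + 1) (Nat.succ_pos N) t le_rfl 1
    refine ⟨c, fun l hl => hc (0, l) ⟨Nat.one_pos, fun r => ?_⟩⟩
    simp only [r.2, if_true, Nat.mul_zero, Nat.zero_add, Nat.zero_le, true_and]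
    exact (hl r).trans (Nat.lt_succ_self N)
  intro N hN s
  induction s with
  | zero =>
    intro _ n
    obtain ⟨c, hc⟩ := hdiag n
    refine ⟨c, fun q hq => ?_⟩
    have : q = (q.1, fun _ => q.1) := Prod.ext rfl (funext fun r => by simpa using hq.2 r)
    rw [this]
    exact hc ⟨q.1, hq.1⟩
  | succ s ih =>
    intro hst n
    have ih := ih (by omega)
    -- `Ψ` speaks about a whole block of `n` consecutive places, with all offsets in the coordinates
    -- already spread.
    let Ψ : L.Formula (κ ⊕ ((Fin n × (Fin t → Fin N)) × ν)) :=
      Formula.iInf fun q : Fin n × (Fin t → Fin N) => ψ.relabel (Sum.map id fun x => (q, x))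
    have hΨ : ∀ (c : κ → M) (z : (Fin n × (Fin t → Fin N)) × ν → M),
        Ψ.Realize (Sum.elim c z) ↔ ∀ q, ψ.Realize (Sum.elim c fun x => z (q, x)) := by
      intro c z
      simp only [Ψ, Formula.realize_iInf, Formula.realize_relabel]
      refine forall_congr' fun q => ?_
      rw [show Sum.elim c z ∘ Sum.map id (fun x => (q, x)) = Sum.elim c fun x => z (q, x) from
        funext fun x => by rcases x with x | x <;> rfl]
    obtain ⟨K, hK⟩ := hntp.exists_bound Ψ N
    -- The array for `Ψ` has one row per block `p`; its column index `j` is an offset in coordinate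
    -- `s`, common to all places of the block. A path `η` is the image of a box for `s` under the
    -- shift `i ↦ K * i + η (i / n)` of that coordinate, hence consistent. NTP₂ then yields one
    -- block with `N` jointly satisfiable offsets, the set `S`.
    let l : ℕ → ℕ → Fin n → (Fin t → Fin N) → Fin t → ℕ := fun p j a b r =>
      if r.val < s then N * (n * p + a) + b r else if r.val = s then K * (n * p + a) + j
      else n * p + a
    obtain ⟨p, -, S, hSK, hSN, c, hc⟩ := hK M
      (fun p j z => e (n * p + z.1.1) (l p j z.1.1 z.1.2) z.2) (by
      intro η hη
      obtain ⟨c, hc⟩ := (transfer _ (spreadBox_finite t s (n * K) N) id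
        (fun r => if r.val = s then fun i => K * i + η (i / n) else id) strictMono_id
        (fun r => by
          by_cases hr : r.val = s
          · simp only [hr, if_true]
            exact strictMono_block (fun i => η (i / n)) id monotone_id (fun i => hη _)
              fun i j h1 h2 => absurd h2 h1.ne
          · simp only [hr, if_false]
            exact strictMono_id)).2 (ih (n * K))
      refine ⟨c, fun p hp => (hΨ _ _).2 fun q => ?_⟩
      have hq := hc (n * p + q.1, fun r => if r.val < s then N * (n * p + q.1) + q.2 r
        else n * p + q.1) ⟨?_, fun r => ?_⟩
      · convert hq using 3
        simp only [id]
        congr 1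
        funext r
        simp only [l]
        by_cases h1 : r.val < s
        · have h2 : r.val ≠ s := by omega
          simp [h1, h2]
        · by_cases h2 : r.val = s
          · have h3 : (n * p + q.1) / n = p := by
              rw [Nat.mul_add_div (by have := q.1.2; omega), Nat.div_eq_of_lt q.1.2, Nat.add_zero]
            simp [h2, h3]
          · simp [h1, h2]
      · have : n * (p + 1) ≤ n * K := Nat.mul_le_mul_left n hp
        have := q.1.2
        rw [Nat.mul_add] at *
        show n * p + q.1 < n * K
        omega
      · by_cases h1 : r.val < s
        · simp [h1]
        · simp [h1])
    have hc' := fun j hj => (hΨ _ _).1 (hc j hj)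
    let σ := S.orderEmbOfFin hSN
    have hσ : ∀ x, σ x < K := fun x => Finset.mem_range.1 (hSK (S.orderEmbOfFin_mem hSN x))
    -- This shift carries the standard box for `s + 1` into the block found: offset `x` at place `i`
    -- in coordinate `s` becomes the `x`-th element of `S` at place `n * p + i`.
    refine (transfer _ (spreadBox_finite t (s + 1) n N) (fun i => n * p + i)
      (fun r => if r.val < s then fun x => N * (n * p) + x else if r.val = s then
        fun x => K * (n * p + x / N) + σ ⟨x % N, Nat.mod_lt _ hN⟩ else fun x => n * p + x)
      (fun i j h => Nat.add_lt_add_left h _) (fun r => ?_)).1 ⟨c, fun q hq => ?_⟩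
    · split_ifs
      · exact fun i j h => Nat.add_lt_add_left h _
      · refine strictMono_block (fun x => σ ⟨x % N, Nat.mod_lt _ hN⟩) (fun x => n * p + x / N)
          (fun x y hxy => Nat.add_le_add_left (Nat.div_le_div_right hxy) _) (fun x => hσ _)
          (fun x y hxy h => σ.strictMono ?_)
        have h1 := Nat.div_add_mod x N
        have h2 := Nat.div_add_mod y N
        have h3 : x / N = y / N := Nat.add_left_cancel h
        rw [h3] at h1
        show x % N < y % N
        omega
      · exact fun i j h => Nat.add_lt_add_left h _
    · have hlt : ∀ r : Fin t, q.2 r - N * q.1 < N ∨ ¬ r.val < s + 1 := fun r => by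
        by_cases h : r.val < s + 1
        · have := hq.2 r
          rw [if_pos h] at this
          left; omega
        · exact Or.inr h
      let b : Fin t → Fin N := fun r => if h : q.2 r - N * q.1 < N then ⟨_, h⟩ else ⟨0, hN⟩
      have hb : ∀ r : Fin t, r.val < s + 1 → (b r : ℕ) = q.2 r - N * q.1 := fun r hr => by
        simp only [b]
        rw [dif_pos ((hlt r).resolve_right (fun h => h hr))]
      have := hc' (σ (b ⟨s, hst⟩)) (S.orderEmbOfFin_mem hSN _) (⟨q.1, hq.1⟩, b)
      convert this using 3
      congr 1
      funext r
      simp only [l]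
      have hr := hq.2 r
      by_cases h1 : r.val < s
      · rw [if_pos (by omega)] at hr
        simp only [h1, if_true, hb r (by omega)]
        rw [Nat.mul_add]
        omega
      · by_cases h2 : r.val = s
        · rw [if_pos (by omega)] at hr
          have hrs : r = ⟨s, hst⟩ := Fin.ext h2
          have e1 : q.2 r = N * q.1 + b r := by rw [hb r (by omega)]; omega
          have e2 : q.2 r / N = q.1 := by
            rw [e1, Nat.mul_add_div hN, Nat.div_eq_of_lt (b r).2, Nat.add_zero]
          have e3 : q.2 r % N = b r := by
            rw [e1, Nat.mul_add_mod, Nat.mod_eq_of_lt (b r).2]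
          simp only [h2, lt_irrefl, if_false, if_true, e2]
          congr 2
          rw [← hrs]
          congr 1
        · rw [if_neg (by omega)] at hr
          simp only [h1, h2, if_false, hr]

end Array

/-! ### The amalgamation lemma over an array of interleaved sequences. -/

/-- The sequence `x 0, y 0, x 1, y 1, …`. -/
def interleave {X : Type*} (x y : ℕ → X) (i : ℕ) : X := if i % 2 = 0 then x (i / 2) else y (i / 2)

section Amalgam

/-- The positions are ordered lexicographically by block and place, so moving the blocks along an
increasing map keeps the order type. -/
theorem EMLike.block {ν : Type*} {M : Type w₁} [L.Structure M] {c : ℕ → ν → M} (hc : EMLike L c c)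
    {b : ℕ} (pos : ℕ → Fin b → ℕ) (h1 : ∀ i j u v, i < j → pos i u < pos j v)
    (h2 : ∀ i u v, u < v → pos i u < pos i v) :
    EMLike L (fun i (p : Fin b × ν) => c (pos i p.1) p.2)
      (fun i (p : Fin b × ν) => c (pos i p.1) p.2) := by
  have hlt : ∀ i u j v, pos i u < pos j v ↔ i < j ∨ (i = j ∧ u < v) := by
    intro i u j v
    constructor
    · intro h
      rcases lt_trichotomy i j with h3 | h3 | h3
      · exact Or.inl h3
      · subst h3
        refine Or.inr ⟨rfl, ?_⟩
        rcases lt_trichotomy u v with h4 | h4 | h4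
        · exact h4
        · subst h4; exact absurd h (lt_irrefl _)
        · exact absurd (h2 i _ _ h4) h.asymm
      · exact absurd (h1 _ _ v u h3) h.asymm
    · rintro (h | ⟨rfl, h⟩)
      · exact h1 _ _ _ _ h
      · exact h2 _ _ _ h
  intro k ψ o ho
  have := (hc.sameType hc (X := Fin k × Fin b) (fun p => pos (o p.1) p.2) (fun p => pos p.1 p.2)
    (fun x y => by rw [hlt, hlt, ho.lt_iff_lt, ho.injective.eq_iff, Fin.lt_def, Fin.ext_iff])).comp
    (fun p : Fin k × (Fin b × ν) => ((p.1, p.2.1), p.2.2))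
  exact this ψ

variable {ν γ V : Type} [Finite ν] {t : ℕ}

/-- Amalgamation over an indiscernible sequence: a tuple `G` over which the sequence `α` is
indiscernible has a conjugate which is related in the same way to each of the sequences obtained by
interleaving `b` with the sequences `c l`. -/
theorem Theory.exists_conjugate_over_array (hres : T.IsOmegaResilient) (hntp : T.IsNTP₂)
    {M₁ : Type w₁} [L.Structure M₁] [Nonempty M₁] (G : γ → M₁) (α : ℕ → ν → M₁)
    (hα : ∀ s : ℕ → ℕ, StrictMono s → SameType L (Sum.elim G fun p : ℕ × ν => α (s p.1) p.2)
      (Sum.elim G fun p : ℕ × ν => α p.1 p.2))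
    (M₂ : Theory.ModelType.{u, v, max u v} T) (w : V → M₂) (b : ℕ → ν → V)
    (c : (Fin t → ℕ) → ℕ → ν → V)
    (hint : ∀ l, SameType L (fun p : ℕ × ν => w (interleave b (c l) p.1 p.2))
      (fun p : ℕ × ν => α p.1 p.2))
    (hinv : ∀ (s₀ : ℕ → ℕ) (s : Fin t → ℕ → ℕ), StrictMono s₀ → (∀ r, StrictMono (s r)) →
      SameType L (Sum.elim (fun p : ℕ × ν => w (b (s₀ p.1) p.2))
        fun p : (Fin t → ℕ) × ℕ × ν => w (c (fun r => s r (p.1 r)) (s₀ p.2.1) p.2.2))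
        (Sum.elim (fun p : ℕ × ν => w (b p.1 p.2))
        fun p : (Fin t → ℕ) × ℕ × ν => w (c p.1 p.2.1 p.2.2))) :
    ∃ (N : Theory.ModelType.{u, v, max u v} T) (w' : V → N) (G' : γ → N), SameType L w' w ∧
      ∀ l, SameType L (Sum.elim G' fun p : ℕ × ν => w' (interleave b (c l) p.1 p.2))
        (Sum.elim G fun p : ℕ × ν => α p.1 p.2) := by
  classical
  have hαα : EMLike L α α := EMLike.of_shift fun s hs => (hα s hs).comp Sum.inr
  have hJ : ∀ l, EMLike L (fun i x => w (interleave b (c l) i x))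
      (fun i x => w (interleave b (c l) i x)) := fun l =>
    (hαα.of_sameType (hint l)).self
  have core : ∀ (χ : L.Formula (γ ⊕ (ℕ × ν))), χ.Realize (Sum.elim G fun p => α p.1 p.2) →
      ∀ N, ∃ y : γ → M₂, ∀ l : Fin t → ℕ, (∀ r, l r < N) →
        χ.Realize (Sum.elim y fun p => w (interleave b (c l) p.1 p.2)) := by
    intro χ hχ N
    let S := BoundedFormula.freeVarFinset χ
    -- Windows of length `2 * m` contain every sequence index occurring in `χ`; the summand `1` also
    -- keeps `m` positive.
    let m : ℕ := S.sup (Sum.elim (fun _ => 0) fun p => p.1) + 1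
    have hm : ∀ p, Sum.inr p ∈ S → p.1 < 2 * m := fun p hp => by
      have : p.1 ≤ S.sup (Sum.elim (fun _ => 0) fun p => p.1) :=
        Finset.le_sup (f := Sum.elim (fun _ => 0) fun p => p.1) hp
      omega
    let g : S → S ⊕ (Fin (2 * m) × ν) := fun a => match a with
      | ⟨Sum.inl x, h⟩ => Sum.inl ⟨Sum.inl x, h⟩
      | ⟨Sum.inr p, h⟩ => Sum.inr (⟨p.1, hm p h⟩, p.2)
    let ψ : L.Formula (S ⊕ (Fin (2 * m) × ν)) := BoundedFormula.restrictFreeVar χ g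
    have hψ₁ : ∀ (y : S → M₁) (d : Fin (2 * m) × ν → M₁)
        (z : γ ⊕ (ℕ × ν) → M₁), (∀ x (h : Sum.inl x ∈ S), y ⟨_, h⟩ = z (Sum.inl x)) →
        (∀ p, d p = z (Sum.inr (p.1, p.2))) → (ψ.Realize (Sum.elim y d) ↔ χ.Realize z) := by
      intro y d z h1 h2
      refine BoundedFormula.realize_restrictFreeVar _ ?_
      rintro ⟨x | p, h⟩
      · exact h1 x h
      · exact h2 _
    have hψ₂ : ∀ (y : S → M₂) (d : Fin (2 * m) × ν → M₂)
        (z : γ ⊕ (ℕ × ν) → M₂), (∀ x (h : Sum.inl x ∈ S), y ⟨_, h⟩ = z (Sum.inl x)) →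
        (∀ p, d p = z (Sum.inr (p.1, p.2))) → (ψ.Realize (Sum.elim y d) ↔ χ.Realize z) := by
      intro y d z h1 h2
      refine BoundedFormula.realize_restrictFreeVar _ ?_
      rintro ⟨x | p, h⟩
      · exact h1 x h
      · exact h2 _
    -- The base is cut into segments of length `3 * m`. The first `2 * m` terms of segment `i` form
    -- the window `A i`; the last `m`, interleaved with as many terms of `c l`, form the window `e i
    -- l` of the same length.
    let e : ℕ → (Fin t → ℕ) → Fin (2 * m) × ν → M₂ := fun i l p =>
      w (interleave b (c l) (2 * (3 * m * i + 2 * m) + p.1) p.2)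
    let A : ℕ → Fin (2 * m) × ν → M₂ := fun i p => w (b (3 * m * i + p.1) p.2)
    have hA2 : ∀ l i p, A i p = w (interleave b (c l) (2 * (3 * m * i + p.1)) p.2) := by
      intro l i p
      simp [A, interleave]
    have hmono : ∀ i j, i < j → 3 * m * i + 3 * m ≤ 3 * m * j := fun i j h => by
      have : 3 * m * (i + 1) ≤ 3 * m * j := Nat.mul_le_mul_left _ h
      rwa [Nat.mul_add, Nat.mul_one] at this
    -- The windows `A i` together with the one window `e k (k, …, k)` all lie in the single
    -- indiscernible sequence with array index constantly `k`, as successive blocks.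
    have hins : ∀ k, EMLike L (insertAfter A k (e k fun _ => k))
        (insertAfter A k (e k fun _ => k)) := by
      intro k
      let pos : ℕ → Fin (2 * m) → ℕ := fun i x => if i ≤ k then 2 * (3 * m * i + x) else
        if i = k + 1 then 2 * (3 * m * k + 2 * m) + x else 2 * (3 * m * (i - 1) + x)
      have := (hJ fun _ => k).block pos (fun i j x y hij => by
          have hx := x.2
          have hy := y.2
          simp only [pos]
          split_ifs with h1 h2 h3 h4 h5
          · have := hmono i j hij; omega
          · rcases (Nat.lt_or_ge i k) with h6 | h6
            · have := hmono i k h6; omega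
            · have : i = k := by omega
              subst this; omega
          · have := hmono i (j - 1) (by omega); omega
          · omega
          · omega
          · have := hmono k (j - 1) (by omega); omega
          · omega
          · omega
          · have := hmono (i - 1) (j - 1) (by omega); omega) (fun i x y hxy => by
          have : (x : ℕ) < y := hxy
          simp only [pos]
          split_ifs <;> omega)
      convert this using 1 <;>
      · funext i p
        simp only [insertAfter, pos]
        split_ifs
        · exact hA2 _ _ _
        · rfl
        · exact hA2 _ _ _
    -- Base windows lie in any of the interleaved copies of `α`, and `G` solves all the
    -- corresponding windows of `α` because `α` is indiscernible over `G`.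
    have hcons : ∀ n, ∃ y : S → M₂, ∀ i : Fin n, ψ.Realize (Sum.elim y (A i)) := by
      intro n
      have h1 := (hint fun _ => 0).exists_iff (Q := Fin n) (κ := S) (fun _ => ψ)
        (fun i (p : Fin (2 * m) × ν) => (2 * (3 * m * i + p.1), p.2))
      have h2 : ∀ i : Fin n, A i = fun p => w (interleave b (c fun _ => 0)
          (2 * (3 * m * i + p.1)) p.2) := fun i => funext fun p => hA2 _ _ _
      simp only [h2]
      refine h1.2 ⟨fun a => Sum.elim G (fun _ => Classical.arbitrary _) a.1, fun i => ?_⟩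
      refine (hψ₁ _ _ (Sum.elim G fun p => α (2 * (3 * m * i + p.1)) p.2) (fun x _ => rfl)
        (fun p => rfl)).2 ?_
      exact (hα (fun x => 2 * (3 * m * i + x)) (fun x y h => by
        show 2 * (3 * m * i + x) < 2 * (3 * m * i + y)
        omega) χ).2 hχ
    have hinve : ∀ (s₀ : ℕ → ℕ) (s : Fin t → ℕ → ℕ), StrictMono s₀ → (∀ r, StrictMono (s r)) →
        SameType L (fun p : ℕ × (Fin t → ℕ) × (Fin (2 * m) × ν) =>
          e (s₀ p.1) (fun r => s r (p.2.1 r)) p.2.2) (fun p => e p.1 p.2.1 p.2.2) := by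
      intro s₀ s hs₀ hs
      have hm0 : 0 < 3 * m := by omega
      have h1 := hinv (fun i => 3 * m * s₀ (i / (3 * m)) + i % (3 * m)) s
        (strictMono_block (fun i => i % (3 * m)) (fun i => s₀ (i / (3 * m)))
          (fun x y h => hs₀.monotone (Nat.div_le_div_right h)) (fun i => Nat.mod_lt _ hm0)
          (fun i j hij h => by
            have h3 := hs₀.injective h
            have h4 := Nat.div_add_mod i (3 * m)
            have h5 := Nat.div_add_mod j (3 * m)
            rw [h3] at h4
            omega)) hs
      have h2 := h1.comp (fun p : ℕ × (Fin t → ℕ) × (Fin (2 * m) × ν) =>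
        if p.2.2.1.val % 2 = 0 then Sum.inl (3 * m * p.1 + (2 * m + p.2.2.1 / 2), p.2.2.2)
        else Sum.inr (p.2.1, 3 * m * p.1 + (2 * m + p.2.2.1 / 2), p.2.2.2))
      have e1 : ∀ i (x : Fin (2 * m)), (2 * (3 * m * i + 2 * m) + x.val) % 2 = x.val % 2 := by
        intro i x; omega
      have e2 : ∀ i (x : Fin (2 * m)), (2 * (3 * m * i + 2 * m) + x.val) / 2 =
          3 * m * i + (2 * m + x.val / 2) := by
        intro i x; omega
      have e3 : ∀ i (x : Fin (2 * m)), (3 * m * i + (2 * m + x.val / 2)) / (3 * m) = i := by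
        intro i x
        have := x.2
        rw [Nat.mul_add_div hm0, Nat.div_eq_of_lt (by omega), Nat.add_zero]
      have e4 : ∀ i (x : Fin (2 * m)), (3 * m * i + (2 * m + x.val / 2)) % (3 * m) =
          2 * m + x.val / 2 := by
        intro i x
        have := x.2
        rw [Nat.mul_add_mod, Nat.mod_eq_of_lt (by omega)]
      convert h2 using 1
      · funext p
        simp only [e, interleave, e1, e2]
        split_ifs with h
        · simp only [Sum.elim_inl, e3, e4]
        · simp only [Sum.elim_inr, e3, e4]
      · funext p
        simp only [e, interleave, e1, e2]
        split_ifs with h <;> rfl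
    -- Resilience replaces `A i` by the diagonal windows of some subsequence; invariance of the
    -- array removes the subsequence.
    have hdiag : ∀ n, ∃ y : S → M₂, ∀ i : Fin n, ψ.Realize (Sum.elim y (e i fun _ => i)) := by
      intro n
      obtain ⟨s, hs, h⟩ := hres.exists_consistent_subsequence M₂ A (fun k => e k fun _ => k)
        hins ψ hcons n
      exact ((hinve s (fun _ => s) hs fun _ => hs).exists_iff (Q := Fin n) (κ := S) (fun _ => ψ)
        (fun i (p : Fin (2 * m) × ν) => (i.val, fun _ => i.val, p))).1 h
    obtain ⟨y, hy⟩ := hntp.row_consistent M₂ e hinve ψ hdiag N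
    -- The windows `e 0 l` start at base index `2 * m`; this shift brings them back to the
    -- beginning.
    have h1 := (hinv (fun i => 2 * m + i) (fun _ => id) (fun x y h => Nat.add_lt_add_left h _)
      fun _ => strictMono_id).exists_iff (Q := Fin t → Fin N) (κ := S) (fun _ => ψ)
      (fun l (p : Fin (2 * m) × ν) => if p.1.val % 2 = 0 then Sum.inl (p.1.val / 2, p.2)
        else Sum.inr (fun r => l r, p.1.val / 2, p.2))
    obtain ⟨y', hy'⟩ := h1.1 ⟨y, fun l => by
      convert hy (fun r => l r) (fun r => (l r).2) using 2
      funext p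
      simp only [e, interleave]
      rw [show (2 * (3 * m * 0 + 2 * m) + p.1.val) % 2 = p.1.val % 2 by omega,
        show (2 * (3 * m * 0 + 2 * m) + p.1.val) / 2 = 2 * m + p.1.val / 2 by omega]
      split_ifs with h <;> rfl⟩
    refine ⟨fun x => if h : Sum.inl x ∈ S then y' ⟨_, h⟩ else Classical.arbitrary M₂,
      fun l hl => ?_⟩
    refine (hψ₂ _ _ _ (fun x h => ?_) (fun p => ?_)).1 (hy' fun r => ⟨l r, hl r⟩)
    · simp [h]
    · simp only [interleave, Sum.elim_inr]
      split_ifs with h <;> rfl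
  let ρ : (Fin t → ℕ) → γ ⊕ (ℕ × ν) → V ⊕ γ := fun l =>
    Sum.elim Sum.inr fun p => Sum.inl (interleave b (c l) p.1 p.2)
  obtain ⟨N, z, hz⟩ := Theory.exists_realize_of_finset (T := T)
    ({χ : L.Formula (V ⊕ γ) | ∃ ψ : L.Formula V, ψ.Realize w ∧ χ = ψ.relabel Sum.inl} ∪
      {χ | ∃ (l : Fin t → ℕ) (ψ : L.Formula (γ ⊕ (ℕ × ν))),
        ψ.Realize (Sum.elim G fun p => α p.1 p.2) ∧ ψ.relabel (ρ l) = χ}) (by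
    intro s hs
    let Q := {χ : s // ∃ (l : Fin t → ℕ) (ψ : L.Formula (γ ⊕ (ℕ × ν))),
        ψ.Realize (Sum.elim G fun p => α p.1 p.2) ∧ ψ.relabel (ρ l) = χ.1}
    have hQ : ∀ q : Q, ∃ (l : Fin t → ℕ) (ψ : L.Formula (γ ⊕ (ℕ × ν))),
        ψ.Realize (Sum.elim G fun p => α p.1 p.2) ∧ ψ.relabel (ρ l) = q.1.1 := fun q => q.2
    choose l ψ hψ hψ' using hQ
    have : Fintype Q := Fintype.ofFinite Q
    obtain ⟨y, hy⟩ := core (Formula.iInf ψ) (by rw [Formula.realize_iInf]; exact hψ)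
      ((Finset.univ.sup fun q => Finset.univ.sup (l q)) + 1)
    refine ⟨M₂, inferInstance, inferInstance, M₂.is_model, Sum.elim w y, fun χ hχ => ?_⟩
    rcases hs hχ with ⟨θ, hθ, rfl⟩ | h
    · rw [Formula.realize_relabel]; exact hθ
    · have h1 := hy (l ⟨⟨χ, hχ⟩, h⟩) (fun r => Nat.lt_succ_of_le
        ((Finset.le_sup (f := l ⟨⟨χ, hχ⟩, h⟩) (Finset.mem_univ r)).trans
          (Finset.le_sup (f := fun q => Finset.univ.sup (l q)) (Finset.mem_univ _))))
      rw [Formula.realize_iInf] at h1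
      have h2 := hψ' ⟨⟨χ, hχ⟩, h⟩
      refine Eq.mp (congrArg (fun θ : L.Formula (V ⊕ γ) => θ.Realize (Sum.elim w y)) h2) ?_
      rw [Formula.realize_relabel]
      convert h1 ⟨⟨χ, hχ⟩, h⟩ using 1
      ext x; rcases x with x | x <;> rfl)
  refine ⟨N, fun x => z (Sum.inl x), fun x => z (Sum.inr x), ?_, fun l => ?_⟩
  · refine (SameType.of_imp fun ψ hψ => ?_).symm
    have := hz _ (Or.inl ⟨ψ, hψ, rfl⟩)
    rwa [Formula.realize_relabel] at this
  · refine (SameType.of_imp fun ψ hψ => ?_).symm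
    have := hz _ (Or.inr ⟨l, ψ, hψ, rfl⟩)
    rw [Formula.realize_relabel] at this
    convert this using 1
    ext x; rcases x with x | x <;> rfl

end Amalgam

/-! ### Properties preserved under limits of types. -/

section Limit

variable {I V : Type*} {M : I → Type w₁} [∀ i, L.Structure (M i)] {N : Type w₂} [L.Structure N]
  {M₀ : Type w₃} [L.Structure M₀]

/-- Every formula that holds eventually along the filter `f` holds in the limit. -/
def IsTypeLimit (L : Language.{u, v}) {I V : Type*} {M : I → Type w₁} [∀ i, L.Structure (M i)]
    {N : Type w₂} [L.Structure N] (f : Filter I) (z : ∀ i, V → M i) (z' : V → N) : Prop :=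
  ∀ ψ : L.Formula V, (∀ᶠ i in f, ψ.Realize (z i)) → ψ.Realize z'

theorem IsTypeLimit.comp {f : Filter I} {z : ∀ i, V → M i} {z' : V → N}
    (h : IsTypeLimit L f z z') {U : Type*} (g : U → V) :
    IsTypeLimit L f (fun i x => z i (g x)) (fun x => z' (g x)) := by
  intro ψ hψ
  have := h (ψ.relabel g) (by
    simp only [Formula.realize_relabel]; exact hψ)
  rwa [Formula.realize_relabel] at this

theorem IsTypeLimit.emLike {f : Filter I} {ν : Type*} {a : ℕ → ν → M₀} {O : Type*} [Preorder O]
    {z : ∀ i, V → M i} {z' : V → N} (h : IsTypeLimit L f z z') (g : O → ν → V)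
    (hz : ∀ (k : ℕ) (o : Fin k → O), StrictMono o → ∀ᶠ i in f, ∀ ψ : L.Formula (Fin k × ν),
      (ψ.Realize (fun p => z i (g (o p.1) p.2)) ↔ ψ.Realize (fun p => a p.1 p.2))) :
    EMLike L a fun o x => z' (g o x) := by
  intro k ψ o ho
  have h1 := h.comp (fun p : Fin k × ν => g (o p.1) p.2)
  have h2 : ∀ θ : L.Formula (Fin k × ν), θ.Realize (fun p => a p.1 p.2) →
      θ.Realize (fun p => z' (g (o p.1) p.2)) := fun θ hθ =>
    h1 θ ((hz k o ho).mono fun i hi => (hi θ).2 hθ)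
  refine ⟨fun hp => ?_, h2 ψ⟩
  by_contra hn
  exact Formula.realize_not.1 (h2 ψ.not (Formula.realize_not.2 hn)) hp

theorem IsTypeLimit.inconsistentFamily [∀ i, Nonempty (M i)] [Nonempty N] {f : Filter I}
    {n m : ℕ} {φ : L.Formula (Fin n ⊕ Fin m)} {k : ℕ} {z : ∀ i, ℕ → Fin m → M i}
    {z' : ℕ → Fin m → N}
    (h : IsTypeLimit L f (fun i (p : ℕ × Fin m) => z i p.1 p.2) (fun p : ℕ × Fin m => z' p.1 p.2))
    (hz : ∀ᶠ i in f, InconsistentFamily k φ (z i)) : InconsistentFamily k φ z' := by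
  rintro s hs ⟨c, hc⟩
  have := h (consFormula (fun _ : s => φ) fun i x => (i.1, x)).not (hz.mono fun i hi => by
    rw [Formula.realize_not, realize_consFormula]
    rintro ⟨c, hc⟩
    exact hi s hs ⟨c, fun j hj => hc ⟨j, hj⟩⟩)
  rw [Formula.realize_not, realize_consFormula] at this
  exact this ⟨c, fun q => hc q.1 q.2⟩

theorem SameType.isTypeLimit {K : Type w₃} [L.Structure K] {y : V → K} {z' : V → N}
    (h : SameType L z' y) :
    IsTypeLimit L (⊤ : Filter Unit) (fun _ => y) z' := fun ψ hψ =>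
  (h ψ).2 (by simpa using hψ)

theorem InconsistentFamily.comp {n m k : ℕ} {φ : L.Formula (Fin n ⊕ Fin m)} {d : ℕ → Fin m → N}
    (h : InconsistentFamily k φ d) {s : ℕ → ℕ} (hs : Function.Injective s) :
    InconsistentFamily k φ (fun i => d (s i)) := by
  classical
  rintro F hF ⟨c, hc⟩
  refine h (F.image s) (by rw [Finset.card_image_of_injective _ hs, hF]) ⟨c, fun i hi => ?_⟩
  obtain ⟨j, hj, rfl⟩ := Finset.mem_image.1 hi
  exact hc j hj

theorem InconsistentFamily.of_sameType {K : Type w₃} [L.Structure K] [Nonempty K] [Nonempty N]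
    {n m k : ℕ} {φ : L.Formula (Fin n ⊕ Fin m)} {d : ℕ → Fin m → K} {d' : ℕ → Fin m → N}
    (hd : InconsistentFamily k φ d)
    (h : SameType L (fun p : ℕ × Fin m => d' p.1 p.2) (fun p : ℕ × Fin m => d p.1 p.2)) :
    InconsistentFamily k φ d' :=
  h.isTypeLimit.inconsistentFamily (Filter.Eventually.of_forall fun _ => hd)

end Limit

/-! ### Configurations and joint families of them. -/

/-- Variables for a sequence `base`, sequences `ins l` to be interleaved with it, and `t` rows of
parameters. -/
inductive ConfigVar (n m t : ℕ) : Type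
  | base (i : ℕ) (x : Fin n)
  | ins (l : Fin t → ℕ) (i : ℕ) (x : Fin n)
  | row (r : Fin t) (j : ℕ) (y : Fin m)

namespace ConfigVar

variable {n m t : ℕ}

/-- The base sequence interleaved with the sequence of index `l`. -/
def seq (l : Fin t → ℕ) : ℕ → Fin n → ConfigVar n m t := interleave base (ins l)

/-- Increasing maps acting on the index of the sequences and on each index of the array. -/
def shift (n m t : ℕ) : ShiftAction (Option (Fin t)) (ConfigVar n m t) where
  act σ
    | base i x => base (σ none i) x
    | ins l i x => ins (fun r => σ (some r) (l r)) (σ none i) x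
    | row r j y => row r (σ (some r) j) y
  act_id x := by cases x <;> rfl
  act_comp σ τ x := by cases x <;> rfl
  act_supp x := by
    cases x with
    | base i x => exact ⟨i + 1, fun σ τ h => by simp [h none i (Nat.lt_succ_self i)]⟩
    | ins l i x =>
      refine ⟨Finset.univ.sup l + i + 1, fun σ τ h => ?_⟩
      have h1 : ∀ r, σ (some r) (l r) = τ (some r) (l r) := fun r => by
        have := Finset.le_sup (f := l) (Finset.mem_univ r)
        exact h _ _ (by omega)
      simp [h none i (by omega), h1]
    | row r j y => exact ⟨j + 1, fun σ τ h => by simp [h (some r) j (Nat.lt_succ_self j)]⟩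

/-- The action on a sequence of configurations, which also moves the index of the sequence. -/
def rowsShift (n m t : ℕ) : ShiftAction (Option (Option (Fin t))) (ℕ × ConfigVar n m t) where
  act σ p := (σ none p.1, (shift n m t).act (fun d => σ (some d)) p.2)
  act_id p := by rw [(shift n m t).act_id]; rfl
  act_comp σ τ p := by rw [← (shift n m t).act_comp]; rfl
  act_supp p := by
    obtain ⟨k, hk⟩ := (shift n m t).act_supp p.2
    refine ⟨k + p.1 + 1, fun σ τ h => ?_⟩
    rw [h none p.1 (by omega), hk _ (fun d => τ (some d)) fun d i hi => h _ i (by omega)]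

theorem shift_seq (σ : Option (Fin t) → ℕ → ℕ) (l : Fin t → ℕ) (i : ℕ) (x : Fin n) :
    (shift n m t).act σ (seq l i x) =
      seq (fun r => σ (some r) (l r)) (2 * σ none (i / 2) + i % 2) x := by
  unfold seq interleave
  have h1 : (2 * σ none (i / 2) + i % 2) % 2 = i % 2 := by omega
  have h2 : (2 * σ none (i / 2) + i % 2) / 2 = σ none (i / 2) := by omega
  rw [h1, h2]
  split_ifs <;> rfl

theorem strictMono_seq {s : ℕ → ℕ} (hs : StrictMono s) :
    StrictMono fun i => 2 * s (i / 2) + i % 2 := by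
  intro i j hij
  show 2 * s (i / 2) + i % 2 < 2 * s (j / 2) + j % 2
  rcases (Nat.div_le_div_right (c := 2) hij.le).lt_or_eq with h | h
  · have := hs h; omega
  · rw [h]; omega

end ConfigVar

section Config

variable {n m t k : ℕ} {φ : L.Formula (Fin n ⊕ Fin m)} {M₀ : Type w₁} [L.Structure M₀]
  {a : ℕ → Fin n → M₀} {M : Type w₂} [L.Structure M] {N : Type w₃} [L.Structure N]

/-- The rows of the configuration are `k`-inconsistent, and the elements of index `l` satisfy the
formulas on the path `l`. -/
def HasRows (φ : L.Formula (Fin n ⊕ Fin m)) (k : ℕ) (z : ConfigVar n m t → M) : Prop :=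
  (∀ l i r, φ.Realize (Sum.elim (fun x => z (.ins l i x)) fun y => z (.row r (l r) y))) ∧
    ∀ r, InconsistentFamily k φ (fun j y => z (.row r j y))

/-- A configuration: the base sequence interleaved with any of the other ones is like `a`. -/
def IsConfig (a : ℕ → Fin n → M₀) (φ : L.Formula (Fin n ⊕ Fin m)) (k : ℕ)
    (z : ConfigVar n m t → M) : Prop :=
  (∀ l, EMLike L a fun i x => z (.seq l i x)) ∧ HasRows φ k z

/-- Along each path, the sequences of the configurations form together a sequence like `a`. -/
def IsJoint (L : Language.{u, v}) {M₀ : Type w₁} [L.Structure M₀] (a : ℕ → Fin n → M₀) {M : Type w₂}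
    [L.Structure M] (z : ℕ → ConfigVar n m t → M) : Prop :=
  ∀ η : ℕ → Fin t → ℕ, EMLike L a fun (o : ℕ ×ₗ ℕ) x =>
    z (ofLex o).1 (.seq (η (ofLex o).1) (ofLex o).2 x)

theorem HasRows.shift {z : ConfigVar n m t → M} (h : HasRows φ k z)
    {σ : Option (Fin t) → ℕ → ℕ} (hσ : ∀ d, StrictMono (σ d)) :
    HasRows φ k (fun x => z ((ConfigVar.shift n m t).act σ x)) :=
  ⟨fun _ _ _ => h.1 _ _ _, fun r => (h.2 r).comp (hσ (some r)).injective⟩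

theorem HasRows.of_isTypeLimit {I : Type*} {M : I → Type w₂} [∀ i, L.Structure (M i)]
    [∀ i, Nonempty (M i)] [Nonempty N] {f : Filter I} {z : ∀ i, ConfigVar n m t → M i}
    {z' : ConfigVar n m t → N} (hl : IsTypeLimit L f z z') (h : ∀ᶠ i in f, HasRows φ k (z i)) :
    HasRows φ k z' := by
  refine ⟨fun l i r => ?_, fun r => ?_⟩
  · have := hl (φ.relabel (Sum.elim (fun x => .ins l i x) fun y => .row r (l r) y))
      (h.mono fun j hj => by
        rw [Formula.realize_relabel]
        convert hj.1 l i r using 1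
        funext x; rcases x with x | x <;> rfl)
    rw [Formula.realize_relabel] at this
    convert this using 1
    funext x; rcases x with x | x <;> rfl
  · exact (hl.comp fun p : ℕ × Fin m => ConfigVar.row r p.1 p.2).inconsistentFamily
      (h.mono fun j hj => hj.2 r)

theorem HasRows.of_sameType [Nonempty M] [Nonempty N] {z : ConfigVar n m t → M}
    {z' : ConfigVar n m t → N} (h : HasRows φ k z) (hs : SameType L z' z) : HasRows φ k z' :=
  HasRows.of_isTypeLimit (I := Unit) (f := ⊤) (M := fun _ => M) (z := fun _ => z)
    (fun ψ hψ => (hs ψ).2 (by simpa using hψ)) (Filter.Eventually.of_forall fun _ => h)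

theorem strictMono_lexMap {s : ℕ → ℕ} (hs : StrictMono s) {g : ℕ → ℕ → ℕ}
    (hg : ∀ i, StrictMono (g i)) :
    StrictMono fun o : ℕ ×ₗ ℕ => toLex (s (ofLex o).1, g (ofLex o).1 (ofLex o).2) := by
  intro o o' h
  rcases (Prod.Lex.lt_iff).1 h with h | ⟨h, h'⟩
  · exact Prod.Lex.lt_iff.2 (Or.inl (hs h))
  · refine Prod.Lex.lt_iff.2 (Or.inr ⟨congrArg s h, ?_⟩)
    show g _ _ < g _ _
    rw [h]
    exact hg _ h'

theorem IsJoint.shift {z : ℕ → ConfigVar n m t → M} (h : IsJoint L a z)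
    {σ : Option (Option (Fin t)) → ℕ → ℕ} (hσ : ∀ d, StrictMono (σ d)) :
    IsJoint L a fun i x =>
      z (σ none i) ((ConfigVar.shift n m t).act (fun d => σ (some d)) x) := by
  intro η
  -- The path is prescribed on the range of `σ none`; its value elsewhere is immaterial.
  have := (h (Function.extend (σ none) (fun i r => σ (some (some r)) (η i r)) fun _ _ => 0)).comp
    (strictMono_lexMap (hσ none) fun _ => ConfigVar.strictMono_seq (hσ (some none)))
  convert this using 3 with o x
  simp only [ConfigVar.shift_seq, ofLex_toLex, (hσ none).injective.extend_apply]

theorem IsConfig.shift {z : ConfigVar n m t → M} (h : IsConfig a φ k z)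
    {σ : Option (Fin t) → ℕ → ℕ} (hσ : ∀ d, StrictMono (σ d)) :
    IsConfig a φ k (fun x => z ((ConfigVar.shift n m t).act σ x)) :=
  ⟨fun l => by
    have := (h.1 (fun r => σ (some r) (l r))).comp (ConfigVar.strictMono_seq (hσ none))
    simpa only [ConfigVar.shift_seq] using this, h.2.shift hσ⟩

/-- Every clause of `IsConfig` holds for all shifts and passes to limits, so it survives extraction.
-/
theorem IsConfig.exists_invariant {M : Theory.ModelType.{u, v, max u v} T}
    {z : ConfigVar n m t → M} (h : IsConfig a φ k z) :
    ∃ (N : Theory.ModelType.{u, v, max u v} T) (y : ConfigVar n m t → N), IsConfig a φ k y ∧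
      ∀ σ : Option (Fin t) → ℕ → ℕ, (∀ d, StrictMono (σ d)) →
        SameType L (fun x => y ((ConfigVar.shift n m t).act σ x)) y := by
  obtain ⟨N, y, hy1, hy2⟩ := Theory.exists_shift_invariant (ConfigVar.shift n m t) M.is_model z
  have hl : IsTypeLimit L (⊤ : Filter {σ : Option (Fin t) → ℕ → ℕ // ∀ d, StrictMono (σ d)})
      (fun σ x => z ((ConfigVar.shift n m t).act σ.1 x)) y := fun ψ hψ =>
    hy1 ψ fun σ hσ => (Filter.eventually_top.1 hψ) ⟨σ, hσ⟩
  refine ⟨N, y, ⟨fun l => ?_, HasRows.of_isTypeLimit hl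
    (Filter.Eventually.of_forall fun σ => h.2.shift σ.2)⟩, hy2⟩
  exact hl.emLike (ConfigVar.seq l) fun q o ho =>
    Filter.Eventually.of_forall fun σ ψ => (h.shift σ.2).1 l q ψ o ho

/-- A finite part of `ℕ ×ₗ ℕ` embeds in `ℕ` by `(i, p) ↦ i * K + p` as soon as `K` exceeds the
second coordinates. -/
theorem exists_emLike_lex [Nonempty M₀] (hM₀ : M₀ ⊨ T) (ha : EMLike L a a) :
    ∃ (N : Theory.ModelType.{u, v, max u v} T) (c : ℕ ×ₗ ℕ → Fin n → N), EMLike L a c := by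
  obtain ⟨N, y, hy⟩ := Theory.exists_limit (T := T) (fun _ => hM₀)
    (fun K (p : (ℕ ×ₗ ℕ) × Fin n) => a ((ofLex p.1).1 * K + (ofLex p.1).2) p.2)
  refine ⟨N, fun o x => y (o, x), IsTypeLimit.emLike (f := Filter.atTop) (M := fun _ => M₀)
    (z := fun K (p : (ℕ ×ₗ ℕ) × Fin n) => a ((ofLex p.1).1 * K + (ofLex p.1).2) p.2) hy
    (fun o x => (o, x)) fun q o ho => ?_⟩
  filter_upwards [Filter.eventually_gt_atTop (Finset.univ.sup fun i => (ofLex (o i)).2)]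
    with K hK ψ
  refine ha q ψ (fun i => (ofLex (o i)).1 * K + (ofLex (o i)).2) fun i j hij => ?_
  have h1 := (Finset.le_sup (f := fun i => (ofLex (o i)).2) (Finset.mem_univ i)).trans_lt hK
  show (ofLex (o i)).1 * K + (ofLex (o i)).2 < (ofLex (o j)).1 * K + (ofLex (o j)).2
  rcases Prod.Lex.lt_iff.1 (ho hij) with h | ⟨h, h'⟩
  · have : ((ofLex (o i)).1 + 1) * K ≤ (ofLex (o j)).1 * K := Nat.mul_le_mul_right K h
    rw [Nat.add_mul, Nat.one_mul] at this
    omega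
  · rw [h]; omega

/-- The starting point of the replacements: no row conditions are imposed yet, so all inserted
sequences at one place coincide and the row entries are arbitrary. -/
theorem exists_isJoint [Nonempty M₀] (hM₀ : M₀ ⊨ T) (ha : EMLike L a a) :
    ∃ (N : Theory.ModelType.{u, v, max u v} T) (z : ℕ → ConfigVar n m t → N), IsJoint L a z := by
  obtain ⟨N, c, hc⟩ := exists_emLike_lex hM₀ ha
  refine ⟨N, fun i => fun
    | .base p x => c (toLex (i, 2 * p)) x
    | .ins _ p x => c (toLex (i, 2 * p + 1)) x
    | .row _ _ _ => Classical.arbitrary N, fun η => ?_⟩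
  convert hc using 3 with o x
  unfold ConfigVar.seq interleave
  split_ifs with h
  · show c (toLex ((ofLex o).1, 2 * ((ofLex o).2 / 2))) x = c o x
    rw [show 2 * ((ofLex o).2 / 2) = (ofLex o).2 by omega]; rfl
  · show c (toLex ((ofLex o).1, 2 * ((ofLex o).2 / 2) + 1)) x = c o x
    rw [show 2 * ((ofLex o).2 / 2) + 1 = (ofLex o).2 by omega]; rfl

/-- A configuration can replace the sequence of index `q` in a joint family. -/
theorem IsJoint.exists_replace (hres : T.IsOmegaResilient) (hntp : T.IsNTP₂)
    {M : Theory.ModelType.{u, v, max u v} T} {z : ℕ → ConfigVar n m t → M} (hz : IsJoint L a z)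
    {K : Theory.ModelType.{u, v, max u v} T} {w : ConfigVar n m t → K} (hw : IsConfig a φ k w)
    (q : ℕ) (hq : ∀ i < q, HasRows φ k (z i)) :
    ∃ (N : Theory.ModelType.{u, v, max u v} T) (z' : ℕ → ConfigVar n m t → N), IsJoint L a z' ∧
      ∀ i < q + 1, HasRows φ k (z' i) := by
  obtain ⟨K, w, hw, hinv⟩ := hw.exists_invariant
  let γ := {i : ℕ // i ≠ q} × ConfigVar n m t
  -- At place `q` one fixed sequence stands in for every path, since it is about to be replaced.
  let j : (ℕ → Fin t → ℕ) → ℕ ×ₗ ℕ → Fin n → γ ⊕ (ℕ × Fin n) := fun η o x =>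
    if h : (ofLex o).1 = q then Sum.inr ((ofLex o).2, x)
    else Sum.inl (⟨(ofLex o).1, h⟩, .seq (η (ofLex o).1) (ofLex o).2 x)
  -- The sequence at place `q` becomes indiscernible over all the other configurations, whose joint
  -- type does not change.
  obtain ⟨N, y, hy1, hy2⟩ := Theory.exists_shift_invariant (seqShift γ (Fin n)) M.is_model
    (Sum.elim (fun p => z p.1 p.2) fun p => z q (.seq (fun _ => 0) p.1 p.2))
  have hl : IsTypeLimit L (⊤ : Filter {σ : Unit → ℕ → ℕ // ∀ d, StrictMono (σ d)})
      (fun σ x => Sum.elim (fun p : γ => z p.1 p.2) (fun p => z q (.seq (fun _ => 0) p.1 p.2))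
        ((seqShift γ (Fin n)).act σ.1 x)) y := fun ψ hψ =>
    hy1 ψ fun σ hσ => (Filter.eventually_top.1 hψ) ⟨σ, hσ⟩
  have hjoint : ∀ η, EMLike L a fun o x => y (j η o x) := by
    intro η
    refine hl.emLike (j η) fun r o ho => Filter.Eventually.of_forall fun σ ψ => ?_
    have h1 := (hz (Function.update η q fun _ => 0)).comp
      (strictMono_lexMap strictMono_id (g := fun i => if i = q then σ.1 () else id) (fun i => by
        by_cases h : i = q
        · simpa [h] using σ.2 ()
        · simpa [h] using strictMono_id))
    convert h1 r ψ o ho using 2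
    funext p
    by_cases h : (ofLex (o p.1)).1 = q
    · simp [j, h, seqShift]
    · simp [j, h, seqShift]
  have hG : SameType L (fun p : γ => y (Sum.inl p)) (fun p : γ => z p.1 p.2) :=
    (SameType.of_imp fun ψ hψ => hl.comp Sum.inl ψ (Filter.Eventually.of_forall fun σ => hψ)).symm
  -- The other configurations are conjugated so that each path sequence of `w` plays the role of the
  -- sequence at place `q`. They keep their own rows, being of the same type as before.
  obtain ⟨P, w', G', hw', hG'⟩ := Theory.exists_conjugate_over_array hres hntp
    (fun p : γ => y (Sum.inl p)) (fun i x => y (Sum.inr (i, x))) (fun s hs => by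
      convert hy2 (fun _ => s) (fun _ => hs) using 1 <;>
      · funext p; rcases p with p | p <;> rfl) K w ConfigVar.base ConfigVar.ins (fun l => by
      have h1 := (hjoint fun _ _ => 0).comp (f := fun p : ℕ => toLex (q, p)) (fun i i' h =>
        Prod.Lex.lt_iff.2 (Or.inr ⟨rfl, h⟩))
      have h2 := (hw.1 l).sameType h1 id id fun _ _ => Iff.rfl
      convert h2 using 1
      · rfl
      · funext p
        simp [j]) (fun s₀ s hs₀ hs => by
      have h1 := (hinv (fun d => d.elim s₀ s) (fun d => by cases d <;> simp [hs₀, hs])).comp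
        (Sum.elim (fun p : ℕ × Fin n => ConfigVar.base p.1 p.2)
          fun p : (Fin t → ℕ) × ℕ × Fin n => ConfigVar.ins p.1 p.2.1 p.2.2)
      convert h1 using 1 <;>
      · funext p; rcases p with p | p <;> rfl)
  refine ⟨P, fun i x => if h : i = q then w' x else G' (⟨i, h⟩, x), fun η => ?_, fun i hi => ?_⟩
  · have h1 := (hG' (η q)).comp (fun p : (ℕ ×ₗ ℕ) × Fin n => j η p.1 p.2)
    refine (hjoint η).of_sameType ?_
    convert h1 using 1
    · funext p
      by_cases h : (ofLex p.1).1 = q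
      · simp only [j, h, dif_pos, Sum.elim_inr]; rfl
      · simp [j, h]
    · funext p
      by_cases h : (ofLex p.1).1 = q
      · simp [j, h]
      · simp [j, h]
  · by_cases h : i = q
    · subst h
      simpa using hw.2.of_sameType hw'
    · have h1 := (hG' fun _ => 0).comp (fun x : ConfigVar n m t =>
        (Sum.inl (⟨i, h⟩, x) : γ ⊕ (ℕ × Fin n)))
      have h2 := hG.comp (fun x : ConfigVar n m t => ((⟨i, h⟩, x) : γ))
      simpa [h] using (hq i (by omega)).of_sameType (h1.trans h2)

/-- From one configuration one obtains an indiscernible joint family of configurations. -/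
theorem IsConfig.exists_joint_family (hres : T.IsOmegaResilient) (hntp : T.IsNTP₂)
    {M : Theory.ModelType.{u, v, max u v} T} {w : ConfigVar n m t → M} (hw : IsConfig a φ k w)
    (ha : EMLike L a a) [Nonempty M₀] (hM₀ : M₀ ⊨ T) :
    ∃ (N : Theory.ModelType.{u, v, max u v} T) (z : ℕ → ConfigVar n m t → N), IsJoint L a z ∧
      (∀ i, HasRows φ k (z i)) ∧
      ∀ σ : Option (Option (Fin t)) → ℕ → ℕ, (∀ d, StrictMono (σ d)) →
        SameType L (fun p : ℕ × ConfigVar n m t =>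
          z (σ none p.1) ((ConfigVar.shift n m t).act (fun d => σ (some d)) p.2))
          (fun p => z p.1 p.2) := by
  have h1 : ∀ q, ∃ (N : Theory.ModelType.{u, v, max u v} T) (z : ℕ → ConfigVar n m t → N),
      IsJoint L a z ∧ ∀ i < q, HasRows φ k (z i) := by
    intro q
    induction q with
    | zero =>
      obtain ⟨N, z, hz⟩ := exists_isJoint (m := m) (t := t) hM₀ ha
      exact ⟨N, z, hz, fun i hi => absurd hi (Nat.not_lt_zero i)⟩
    | succ q ih =>
      obtain ⟨N, z, hz, hq⟩ := ih
      exact hz.exists_replace hres hntp hw q hq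
  choose N z hz hq using h1
  obtain ⟨K, y, hy⟩ := Theory.exists_limit (T := T) (fun q => (N q).is_model)
    (fun q (p : ℕ × ConfigVar n m t) => z q p.1 p.2)
  have hy' : IsTypeLimit L Filter.atTop (fun q (p : ℕ × ConfigVar n m t) => z q p.1 p.2) y := hy
  have hyj : IsJoint L a fun i x => y (i, x) := fun η =>
    hy'.emLike (fun (o : ℕ ×ₗ ℕ) x => ((ofLex o).1, ConfigVar.seq (η (ofLex o).1) (ofLex o).2 x))
      fun r o ho => Filter.Eventually.of_forall fun q ψ => hz q η r ψ o ho
  have hyr : ∀ i, HasRows φ k fun x => y (i, x) := fun i =>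
    HasRows.of_isTypeLimit (hy'.comp fun x : ConfigVar n m t => (i, x))
      ((Filter.eventually_gt_atTop i).mono fun q hiq => hq q i hiq)
  obtain ⟨P, x, hx1, hx2⟩ := Theory.exists_shift_invariant (ConfigVar.rowsShift n m t) K.is_model y
  have hl : IsTypeLimit L
      (⊤ : Filter {σ : Option (Option (Fin t)) → ℕ → ℕ // ∀ d, StrictMono (σ d)})
      (fun σ p => y ((ConfigVar.rowsShift n m t).act σ.1 p)) x := fun ψ hψ =>
    hx1 ψ fun σ hσ => (Filter.eventually_top.1 hψ) ⟨σ, hσ⟩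
  refine ⟨P, fun i c => x (i, c), fun η => ?_, fun i => ?_, hx2⟩
  · exact hl.emLike
      (fun (o : ℕ ×ₗ ℕ) x => ((ofLex o).1, ConfigVar.seq (η (ofLex o).1) (ofLex o).2 x))
      fun r o ho => Filter.Eventually.of_forall fun σ ψ => hyj.shift σ.2 η r ψ o ho
  · exact HasRows.of_isTypeLimit (hl.comp fun c : ConfigVar n m t => (i, c))
      (Filter.Eventually.of_forall fun σ =>
        (hyr (σ.1 none i)).shift (σ := fun d => σ.1 (some d)) fun d => σ.2 (some d))

end Config

/-! ### One-row configurations stretched along `ℕ ×ₗ ℕ`. -/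

/-- Variables for a sequence `base` indexed by `ℕ ×ₗ ℕ`, sequences `ins j` to be interleaved with
it, and one row of parameters. -/
inductive RowVar (n m : ℕ) : Type
  | base (i p : ℕ) (x : Fin n)
  | ins (j i p : ℕ) (x : Fin n)
  | par (j : ℕ) (y : Fin m)

namespace RowVar

variable {n m : ℕ}

/-- The `i`-th part of the base sequence interleaved with that of the sequence of index `j`. -/
def seq (j i : ℕ) : ℕ → Fin n → RowVar n m := interleave (base i) (ins j i)

/-- Increasing maps acting on the second index of the sequences and on the index of the row. -/
def shift (n m : ℕ) : ShiftAction Bool (RowVar n m) where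
  act σ
    | base i p x => base i (σ false p) x
    | ins j i p x => ins (σ true j) i (σ false p) x
    | par j y => par (σ true j) y
  act_id x := by cases x <;> rfl
  act_comp σ τ x := by cases x <;> rfl
  act_supp x := by
    cases x with
    | base i p x => exact ⟨p + 1, fun σ τ h => by simp [h false p (Nat.lt_succ_self p)]⟩
    | ins j i p x =>
      exact ⟨j + p + 1, fun σ τ h => by simp [h false p (by omega), h true j (by omega)]⟩
    | par j y => exact ⟨j + 1, fun σ τ h => by simp [h true j (Nat.lt_succ_self j)]⟩

/-- Increasing maps acting on the index of the row, with additional fixed variables. -/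
def parShift (γ : Type) (n m : ℕ) : ShiftAction Unit (γ ⊕ RowVar n m) where
  act σ := Sum.map id ((shift n m).act fun d => bif d then σ () else id)
  act_id x := by
    rcases x with x | x
    · rfl
    · rcases x <;> rfl
  act_comp σ τ x := by
    rcases x with x | x
    · rfl
    · rcases x <;> rfl
  act_supp x := by
    rcases x with x | x
    · exact ⟨0, fun _ _ _ => rfl⟩
    · obtain ⟨k, hk⟩ := (shift n m).act_supp x
      refine ⟨k, fun σ τ h => congrArg Sum.inr (hk _ _ fun d i hi => ?_)⟩
      cases d
      · rfl
      · exact h () i hi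

theorem shift_seq (σ : Bool → ℕ → ℕ) (j i p : ℕ) (x : Fin n) :
    (shift n m).act σ (seq j i p x) = seq (σ true j) i (2 * σ false (p / 2) + p % 2) x := by
  unfold seq interleave
  have h1 : (2 * σ false (p / 2) + p % 2) % 2 = p % 2 := by omega
  have h2 : (2 * σ false (p / 2) + p % 2) / 2 = σ false (p / 2) := by omega
  rw [h1, h2]
  split_ifs <;> rfl

theorem seq_two_mul (j i p : ℕ) (x : Fin n) : (seq j i (2 * p) x : RowVar n m) = base i p x := by
  simp [seq, interleave]

theorem seq_two_mul_add_one (j i p : ℕ) (x : Fin n) :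
    (seq j i (2 * p + 1) x : RowVar n m) = ins j i p x := by
  unfold seq interleave
  rw [if_neg (by omega), show (2 * p + 1) / 2 = p by omega]

end RowVar

theorem ConfigVar.seq_two_mul {n m t : ℕ} (l : Fin t → ℕ) (i : ℕ) (x : Fin n) :
    (ConfigVar.seq l (2 * i) x : ConfigVar n m t) = .base i x := by
  simp [ConfigVar.seq, interleave]

theorem ConfigVar.seq_two_mul_add_one {n m t : ℕ} (l : Fin t → ℕ) (i : ℕ) (x : Fin n) :
    (ConfigVar.seq l (2 * i + 1) x : ConfigVar n m t) = .ins l i x := by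
  unfold ConfigVar.seq interleave
  rw [if_neg (by omega), show (2 * i + 1) / 2 = i by omega]

section Row

variable {n m t k : ℕ} {φ : L.Formula (Fin n ⊕ Fin m)} {M₀ : Type w₁} [L.Structure M₀]
  {a : ℕ → Fin n → M₀} {M : Type w₂} [L.Structure M] {N : Type w₃} [L.Structure N]

/-- The analogue of a configuration with one row for sequences indexed by `ℕ ×ₗ ℕ`. -/
def IsRow (a : ℕ → Fin n → M₀) (φ : L.Formula (Fin n ⊕ Fin m)) (k : ℕ) (z : RowVar n m → M) :
    Prop :=
  (∀ j, EMLike L a fun (o : ℕ ×ₗ ℕ) x => z (.seq j (ofLex o).1 (ofLex o).2 x)) ∧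
    (∀ j i p, φ.Realize (Sum.elim (fun x => z (.ins j i p x)) fun y => z (.par j y))) ∧
      InconsistentFamily k φ (fun j y => z (.par j y))

theorem IsRow.shift {z : RowVar n m → M} (h : IsRow a φ k z) {σ : Bool → ℕ → ℕ}
    (hσ : ∀ d, StrictMono (σ d)) : IsRow a φ k (fun x => z ((RowVar.shift n m).act σ x)) := by
  refine ⟨fun j => ?_, fun _ _ _ => h.2.1 _ _ _, h.2.2.comp (hσ true).injective⟩
  have := (h.1 (σ true j)).comp
    (strictMono_lexMap strictMono_id fun _ => ConfigVar.strictMono_seq (hσ false))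
  simpa only [RowVar.shift_seq, ofLex_toLex, id] using this

theorem IsRow.of_isTypeLimit {I : Type*} {M : I → Type w₂} [∀ i, L.Structure (M i)]
    [∀ i, Nonempty (M i)] [Nonempty N] {f : Filter I} {z : ∀ i, RowVar n m → M i}
    {z' : RowVar n m → N} (hl : IsTypeLimit L f z z') (h : ∀ᶠ i in f, IsRow a φ k (z i)) :
    IsRow a φ k z' := by
  refine ⟨fun j => ?_, fun j i p => ?_, ?_⟩
  · exact hl.emLike (fun (o : ℕ ×ₗ ℕ) x => .seq j (ofLex o).1 (ofLex o).2 x)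
      fun q o ho => h.mono fun i hi ψ => hi.1 j q ψ o ho
  · have := hl (φ.relabel (Sum.elim (fun x => .ins j i p x) fun y => .par j y))
      (h.mono fun i' hi => by
        rw [Formula.realize_relabel]
        convert hi.2.1 j i p using 1
        funext x; rcases x with x | x <;> rfl)
    rw [Formula.realize_relabel] at this
    convert this using 1
    funext x; rcases x with x | x <;> rfl
  · exact (hl.comp fun p : ℕ × Fin m => RowVar.par p.1 p.2).inconsistentFamily
      (h.mono fun j hj => hj.2.2)

theorem IsRow.of_sameType [Nonempty M] [Nonempty N] {z : RowVar n m → M}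
    {z' : RowVar n m → N} (h : IsRow a φ k z) (hs : SameType L z' z) : IsRow a φ k z' :=
  IsRow.of_isTypeLimit (I := Unit) (f := ⊤) (M := fun _ => M) (z := fun _ => z)
    (fun ψ hψ => (hs ψ).2 (by simpa using hψ)) (Filter.Eventually.of_forall fun _ => h)

/-- A configuration with one row can be stretched. -/
theorem IsConfig.exists_isRow {K : Theory.ModelType.{u, v, max u v} T} {w : ConfigVar n m 1 → K}
    (hw : IsConfig a φ k w) :
    ∃ (N : Theory.ModelType.{u, v, max u v} T) (z : RowVar n m → N), IsRow a φ k z ∧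
      ∀ σ : Bool → ℕ → ℕ, (∀ d, StrictMono (σ d)) →
        SameType L (fun x => z ((RowVar.shift n m).act σ x)) z := by
  -- Segment `i` is read off from base index `i * Q` on. Any finite set of indices is in the right
  -- order for large `Q`, so the limit over `Q` is stretched.
  let g : ℕ → RowVar n m → ConfigVar n m 1 := fun Q x => match x with
    | .base i p x => .base (i * Q + p) x
    | .ins j i p x => .ins (fun _ => j) (i * Q + p) x
    | .par j y => .row 0 j y
  have hg : ∀ Q j i p x, g Q (.seq j i p x) = .seq (fun _ => j) (i * (2 * Q) + p) x := by
    intro Q j i p x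
    rw [show i * (2 * Q) = 2 * (i * Q) by ring]
    unfold RowVar.seq ConfigVar.seq interleave
    rw [show (2 * (i * Q) + p) % 2 = p % 2 by omega,
      show (2 * (i * Q) + p) / 2 = i * Q + p / 2 by omega]
    split_ifs <;> rfl
  obtain ⟨N, y, hy⟩ := Theory.exists_limit (T := T) (fun _ => K.is_model) fun Q x => w (g Q x)
  have hl : IsTypeLimit L Filter.atTop (fun Q x => w (g Q x)) y := hy
  have hrow : IsRow a φ k y := by
    refine ⟨fun j => ?_, fun j i p => ?_, ?_⟩
    · refine hl.emLike (fun (o : ℕ ×ₗ ℕ) x => .seq j (ofLex o).1 (ofLex o).2 x) fun q o ho => ?_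
      filter_upwards [Filter.eventually_gt_atTop (Finset.univ.sup fun i => (ofLex (o i)).2)]
        with Q hQ ψ
      simp only [hg]
      refine hw.1 _ q ψ (fun i => (ofLex (o i)).1 * (2 * Q) + (ofLex (o i)).2) fun i j hij => ?_
      have h1 := (Finset.le_sup (f := fun i => (ofLex (o i)).2) (Finset.mem_univ i)).trans_lt hQ
      show (ofLex (o i)).1 * (2 * Q) + (ofLex (o i)).2 < (ofLex (o j)).1 * (2 * Q) + (ofLex (o j)).2
      rcases Prod.Lex.lt_iff.1 (ho hij) with h | ⟨h, h'⟩
      · have : ((ofLex (o i)).1 + 1) * (2 * Q) ≤ (ofLex (o j)).1 * (2 * Q) :=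
          Nat.mul_le_mul_right _ h
        rw [Nat.add_mul, Nat.one_mul] at this
        omega
      · rw [h]; omega
    · have := hl (φ.relabel (Sum.elim (fun x => .ins j i p x) fun y => .par j y))
        (Filter.Eventually.of_forall fun Q => by
          rw [Formula.realize_relabel]
          convert hw.2.1 (fun _ => j) (i * Q + p) 0 using 1
          funext x; rcases x with x | x <;> rfl)
      rw [Formula.realize_relabel] at this
      convert this using 1
      funext x; rcases x with x | x <;> rfl
    · exact (hl.comp fun p : ℕ × Fin m => RowVar.par p.1 p.2).inconsistentFamily
        (Filter.Eventually.of_forall fun Q => hw.2.2 0)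
  obtain ⟨P, x, hx1, hx2⟩ := Theory.exists_shift_invariant (RowVar.shift n m) N.is_model y
  have hl' : IsTypeLimit L (⊤ : Filter {σ : Bool → ℕ → ℕ // ∀ d, StrictMono (σ d)})
      (fun σ x => y ((RowVar.shift n m).act σ.1 x)) x := fun ψ hψ =>
    hx1 ψ fun σ hσ => (Filter.eventually_top.1 hψ) ⟨σ, hσ⟩
  exact ⟨P, x, IsRow.of_isTypeLimit hl' (Filter.Eventually.of_forall fun σ => hrow.shift σ.2), hx2⟩

end Row

/-! ### Common realizations over all paths. -/

section Common

variable {t : ℕ}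

/-- If the diagonal of an indiscernible array has a common realization of a set of formulas, then so
does its first row. -/
theorem Theory.IsNTP₂.exists_common_realization (hntp : T.IsNTP₂) {W P Y : Type}
    {M : Theory.ModelType.{u, v, max u v} T} (z : ℕ → W → M) (ρ : (Fin t → ℕ) → P → W)
    (hinv : ∀ (s₀ : ℕ → ℕ) (s : Fin t → ℕ → ℕ), StrictMono s₀ → (∀ r, StrictMono (s r)) →
      SameType L (fun p : ℕ × (Fin t → ℕ) × P => z (s₀ p.1) (ρ (fun r => s r (p.2.1 r)) p.2.2))
        (fun p => z p.1 (ρ p.2.1 p.2.2)))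
    (Θ : Set (L.Formula (Y ⊕ P)))
    (hΘ : ∀ q, ∃ (K : Theory.ModelType.{u, v, max u v} T) (y : Y → K) (e : Fin q → P → K),
      SameType L (fun p : Fin q × P => e p.1 p.2) (fun p => z p.1 (ρ (fun _ => p.1) p.2)) ∧
        ∀ i, ∀ θ ∈ Θ, θ.Realize (Sum.elim y (e i))) :
    ∃ (K : Theory.ModelType.{u, v, max u v} T) (z' : W → K) (y : Y → K), SameType L z' (z 0) ∧
      ∀ l, ∀ θ ∈ Θ, θ.Realize (Sum.elim y fun p => z' (ρ l p)) := by
  classical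
  have core : ∀ (χ : L.Formula (Y ⊕ P)),
      (∀ q, ∃ (K : Theory.ModelType.{u, v, max u v} T) (y : Y → K) (e : Fin q → P → K),
        SameType L (fun p : Fin q × P => e p.1 p.2) (fun p => z p.1 (ρ (fun _ => p.1) p.2)) ∧
          ∀ i, χ.Realize (Sum.elim y (e i))) →
      ∀ B, ∃ y : Y → M, ∀ l : Fin t → ℕ, (∀ r, l r < B) →
        χ.Realize (Sum.elim y fun p => z 0 (ρ l p)) := by
    intro χ hχ B
    -- Restricting to the variables occurring in `χ` makes both tuples finite, as `row_consistent`
    -- requires.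
    let S := BoundedFormula.freeVarFinset χ
    let κ := {y : Y // Sum.inl y ∈ S}
    let ν := {p : P // Sum.inr p ∈ S}
    have : Finite κ := Finite.of_injective (fun y : κ => (⟨_, y.2⟩ : S)) fun y y' h =>
      Subtype.ext (Sum.inl_injective (congrArg Subtype.val h))
    have : Finite ν := Finite.of_injective (fun y : ν => (⟨_, y.2⟩ : S)) fun y y' h =>
      Subtype.ext (Sum.inr_injective (congrArg Subtype.val h))
    let g : S → κ ⊕ ν := fun a => match a with
      | ⟨Sum.inl x, h⟩ => Sum.inl ⟨x, h⟩
      | ⟨Sum.inr p, h⟩ => Sum.inr ⟨p, h⟩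
    let ψ : L.Formula (κ ⊕ ν) := BoundedFormula.restrictFreeVar χ g
    have hψ : ∀ {K : Theory.ModelType.{u, v, max u v} T} (y : κ → K) (d : ν → K) (x : Y ⊕ P → K),
        (∀ i : κ, y i = x (Sum.inl i)) → (∀ p : ν, d p = x (Sum.inr p)) →
        (ψ.Realize (Sum.elim y d) ↔ χ.Realize x) := by
      intro K y d x h1 h2
      refine BoundedFormula.realize_restrictFreeVar _ ?_
      rintro ⟨x | p, h⟩
      · exact h1 ⟨x, h⟩
      · exact h2 ⟨p, h⟩
    obtain ⟨y, hy⟩ := hntp.row_consistent M (fun i l (p : ν) => z i (ρ l p))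
      (fun s₀ s hs₀ hs => (hinv s₀ s hs₀ hs).comp
        fun p : ℕ × (Fin t → ℕ) × ν => (p.1, p.2.1, p.2.2.1)) ψ (fun q => by
        obtain ⟨K, y, e, he, hye⟩ := hχ q
        exact (he.exists_iff (Q := Fin q) (κ := κ) (fun _ => ψ) fun i (p : ν) => (i, p.1)).1
          ⟨fun i => y i, fun i => (hψ _ _ _ (fun _ => rfl) fun _ => rfl).2 (hye i)⟩) B
    refine ⟨fun x => if h : Sum.inl x ∈ S then y ⟨x, h⟩ else Classical.arbitrary M, fun l hl => ?_⟩
    refine (hψ _ _ _ (fun x => ?_) fun p => rfl).1 (hy l hl)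
    simp only [Sum.elim_inl]
    rw [dif_pos x.2]
  let ρ' : (Fin t → ℕ) → Y ⊕ P → Y ⊕ W := fun l => Sum.map id (ρ l)
  obtain ⟨N, x, hx⟩ := Theory.exists_realize_of_finset (T := T)
    ({χ : L.Formula (Y ⊕ W) | ∃ ψ : L.Formula W, ψ.Realize (z 0) ∧ χ = ψ.relabel Sum.inr} ∪
      {χ | ∃ (l : Fin t → ℕ) (θ : L.Formula (Y ⊕ P)), θ ∈ Θ ∧ θ.relabel (ρ' l) = χ}) (by
    intro s hs
    let Q := {χ : s // ∃ (l : Fin t → ℕ) (θ : L.Formula (Y ⊕ P)), θ ∈ Θ ∧ θ.relabel (ρ' l) = χ.1}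
    have hQ : ∀ q : Q, ∃ (l : Fin t → ℕ) (θ : L.Formula (Y ⊕ P)),
      θ ∈ Θ ∧ θ.relabel (ρ' l) = q.1.1 := fun q => q.2
    choose l θ hθ hθ' using hQ
    have : Fintype Q := Fintype.ofFinite Q
    obtain ⟨y, hy⟩ := core (Formula.iInf θ) (fun q => by
        obtain ⟨K, y, e, he, hye⟩ := hΘ q
        refine ⟨K, y, e, he, fun i => ?_⟩
        rw [Formula.realize_iInf]
        exact fun q => hye i _ (hθ q))
      ((Finset.univ.sup fun q => Finset.univ.sup (l q)) + 1)
    refine ⟨M, inferInstance, inferInstance, M.is_model, Sum.elim y (z 0), fun χ hχ => ?_⟩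
    rcases hs hχ with ⟨ψ, hψ, rfl⟩ | h
    · rw [Formula.realize_relabel]; exact hψ
    · have h1 := hy (l ⟨⟨χ, hχ⟩, h⟩) (fun r => Nat.lt_succ_of_le
        ((Finset.le_sup (f := l ⟨⟨χ, hχ⟩, h⟩) (Finset.mem_univ r)).trans
          (Finset.le_sup (f := fun q => Finset.univ.sup (l q)) (Finset.mem_univ _))))
      rw [Formula.realize_iInf] at h1
      have h2 := hθ' ⟨⟨χ, hχ⟩, h⟩
      refine Eq.mp (congrArg (fun θ : L.Formula (Y ⊕ W) => θ.Realize (Sum.elim y (z 0))) h2) ?_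
      rw [Formula.realize_relabel]
      convert h1 ⟨⟨χ, hχ⟩, h⟩ using 1
      ext x; rcases x with x | x <;> rfl)
  refine ⟨N, fun i => x (Sum.inr i), fun i => x (Sum.inl i), ?_, fun l θ hθ => ?_⟩
  · refine (SameType.of_imp fun ψ hψ => ?_).symm
    have := hx _ (Or.inl ⟨ψ, hψ, rfl⟩)
    rwa [Formula.realize_relabel] at this
  · have := hx _ (Or.inr ⟨l, θ, hθ, rfl⟩)
    rw [Formula.realize_relabel] at this
    convert this using 1
    ext x; rcases x with x | x <;> rfl

end Common

/-! ### Adding a row to a configuration. -/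

section Path

variable {n m t k : ℕ} {φ : L.Formula (Fin n ⊕ Fin m)} {M₀ : Type w₁} [L.Structure M₀]
  {a : ℕ → Fin n → M₀} {M : Type w₂} [L.Structure M] {N : Type w₃} [L.Structure N]

/-- Variables for the parameters on a path, the base sequence, and the sequence of that path. -/
abbrev PathVar (n m t : ℕ) : Type := (Fin t × Fin m) ⊕ ((ℕ × Fin n) ⊕ (ℕ × Fin n))

/-- The variables of a configuration that belong to the path `l`. -/
def ConfigVar.path (l : Fin t → ℕ) : PathVar n m t → ConfigVar n m t :=
  Sum.elim (fun p => .row p.1 (l p.1) p.2)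
    (Sum.elim (fun p => .base p.1 p.2) fun p => .ins l p.1 p.2)

/-- The sequence `y` can serve as a new row over the path with values `e`. -/
def IsRowOver (φ : L.Formula (Fin n ⊕ Fin m)) (k : ℕ) (y : ℕ → Fin m → M) (e : PathVar n m t → M) :
    Prop :=
  (∀ p, φ.Realize (Sum.elim (fun x => e (Sum.inr (Sum.inr (p, x)))) (y 0))) ∧
    (∀ j, SameType L
      (Sum.elim (y j) fun p : (Fin t × Fin m) ⊕ (ℕ × Fin n) => e (Sum.map id Sum.inl p))
      (Sum.elim (y 0) fun p : (Fin t × Fin m) ⊕ (ℕ × Fin n) => e (Sum.map id Sum.inl p))) ∧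
      InconsistentFamily k φ y

/-- The formulas expressing `IsRowOver`. -/
def rowFormulas (n m t k : ℕ) (φ : L.Formula (Fin n ⊕ Fin m)) :
    Set (L.Formula ((ℕ × Fin m) ⊕ PathVar n m t)) :=
  (Set.range fun p : ℕ => φ.relabel
      (Sum.elim (fun x => Sum.inr (Sum.inr (Sum.inr (p, x)))) fun y => Sum.inl (0, y))) ∪
    (Set.range fun p : L.Formula (Fin m ⊕ ((Fin t × Fin m) ⊕ (ℕ × Fin n))) × ℕ =>
      (p.1.relabel (Sum.map (fun y => (p.2, y)) (Sum.map id Sum.inl))).iff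
        (p.1.relabel (Sum.map (fun y => (0, y)) (Sum.map id Sum.inl)))) ∪
    (Set.range fun s : {s : Finset ℕ // s.card = k} =>
      (consFormula (fun _ : s.1 => φ) fun i y => Sum.inl (i.1, y)).not)

/-- Being a row over a path is a set of first-order conditions, hence can be transferred from the
diagonal to all paths. -/
theorem isRowOver_iff [Nonempty M] {y : ℕ → Fin m → M} {e : PathVar n m t → M} :
    IsRowOver φ k y e ↔
      ∀ θ ∈ rowFormulas n m t k φ, θ.Realize (Sum.elim (fun p => y p.1 p.2) e) := by
  have h1 : ∀ p, Sum.elim (fun p : ℕ × Fin m => y p.1 p.2) e ∘ (Sum.elim (fun x : Fin n =>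
      Sum.inr (Sum.inr (Sum.inr (p, x)))) fun y : Fin m => Sum.inl (0, y)) =
      Sum.elim (fun x => e (Sum.inr (Sum.inr (p, x)))) (y 0) := fun p => by
    funext x; rcases x with x | x <;> rfl
  have h2 : ∀ j, Sum.elim (fun p : ℕ × Fin m => y p.1 p.2) e ∘ (Sum.map (fun y => (j, y))
      (Sum.map id Sum.inl)) = Sum.elim (y j) fun p : (Fin t × Fin m) ⊕ (ℕ × Fin n) =>
        e (Sum.map id Sum.inl p) := fun j => by
    funext x; rcases x with x | x <;> rfl
  constructor
  · rintro ⟨hφ, ht, hk⟩ θ ((⟨p, rfl⟩ | ⟨p, rfl⟩) | ⟨s, rfl⟩)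
    · rw [Formula.realize_relabel, h1]; exact hφ p
    · rw [Formula.realize_iff, Formula.realize_relabel, Formula.realize_relabel, h2, h2]
      exact ht p.2 p.1
    · rw [Formula.realize_not, realize_consFormula]
      rintro ⟨c, hc⟩
      exact hk s.1 s.2 ⟨c, fun i hi => hc ⟨i, hi⟩⟩
  · intro h
    refine ⟨fun p => ?_, fun j χ => ?_, fun s hs => ?_⟩
    · have := h _ (Or.inl (Or.inl ⟨p, rfl⟩))
      rwa [Formula.realize_relabel, h1] at this
    · have := h _ (Or.inl (Or.inr ⟨(χ, j), rfl⟩))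
      rwa [Formula.realize_iff, Formula.realize_relabel, Formula.realize_relabel, h2, h2] at this
    · have := h _ (Or.inr ⟨⟨s, hs⟩, rfl⟩)
      rw [Formula.realize_not, realize_consFormula] at this
      rintro ⟨c, hc⟩
      exact this ⟨c, fun i => hc i.1 i.2⟩

/-- There is a row over the diagonal paths of an indiscernible joint family of configurations. -/
theorem IsRow.exists_isRowOver_diagonal (hres : T.IsOmegaResilient) (hntp : T.IsNTP₂)
    {N : Theory.ModelType.{u, v, max u v} T} {z : ℕ → ConfigVar n m t → N} (hz : IsJoint L a z)
    (hinv : ∀ σ : Option (Option (Fin t)) → ℕ → ℕ, (∀ d, StrictMono (σ d)) →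
      SameType L (fun p : ℕ × ConfigVar n m t =>
        z (σ none p.1) ((ConfigVar.shift n m t).act (fun d => σ (some d)) p.2))
        (fun p => z p.1 p.2))
    {K : Theory.ModelType.{u, v, max u v} T} {w : RowVar n m → K} (hw : IsRow a φ k w)
    (hwinv : ∀ σ : Bool → ℕ → ℕ, (∀ d, StrictMono (σ d)) →
      SameType L (fun x => w ((RowVar.shift n m).act σ x)) w) (q : ℕ) :
    ∃ (P : Theory.ModelType.{u, v, max u v} T) (y : ℕ → Fin m → P) (e : Fin q → PathVar n m t → P),
      SameType L (fun p : Fin q × PathVar n m t => e p.1 p.2)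
        (fun p => z p.1 (ConfigVar.path (fun _ => p.1) p.2)) ∧ ∀ i, IsRowOver φ k y (e i) := by
  let γ := Fin q × Fin t × Fin m
  -- `G` collects the row entries on the `q` diagonal paths. One term of `α` holds a base term and
  -- the next inserted term of each of these paths; shifting only the sequence index shows that `α`
  -- is indiscernible over `G`.
  let G : γ → N := fun p => z p.1 (.row p.2.1 p.1 p.2.2)
  let α : ℕ → Fin q × Fin 2 × Fin n → N := fun p x =>
    z x.1 (.seq (fun _ => x.1) (2 * p + x.2.1) x.2.2)
  -- Base indices are grouped in threes: two base terms give a term of `b`, the third with its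
  -- inserted term gives a term of `c l`. Thus `b` does not depend on `l`, and within each of the
  -- `q` segments the interleaving has the order pattern of `α`.
  let b : ℕ → Fin q × Fin 2 × Fin n → RowVar n m := fun p x => .base x.1 (3 * p + x.2.1) x.2.2
  let c : (Fin 1 → ℕ) → ℕ → Fin q × Fin 2 × Fin n → RowVar n m := fun l p x =>
    .seq (l 0) x.1 (2 * (3 * p + 2) + x.2.1) x.2.2
  let pos : ℕ → ℕ → ℕ := fun p u =>
    if p % 2 = 0 then 2 * (3 * (p / 2) + u) else 2 * (3 * (p / 2) + 2) + u
  have hbc : ∀ l p x, interleave b (c l) p x = .seq (l 0) x.1 (pos p x.2.1) x.2.2 := by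
    intro l p x
    simp only [interleave, pos, b, c]
    split_ifs with h
    · rw [RowVar.seq_two_mul]
    · rfl
  obtain ⟨P, w', G', hw', hG'⟩ := Theory.exists_conjugate_over_array hres hntp G α (fun s hs => by
      have h1 := (hinv (fun d => if d = some none then s else id) (fun d => by
        split_ifs
        · exact hs
        · exact strictMono_id)).comp (Sum.elim (fun p : γ => (p.1.val, .row p.2.1 p.1 p.2.2))
          fun p : ℕ × Fin q × Fin 2 × Fin n =>
            (p.2.1.val, .seq (fun _ => p.2.1) (2 * p.1 + p.2.2.1) p.2.2.2))
      convert h1 using 1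
      · funext p
        rcases p with p | p
        · rfl
        · have e1 : (2 * p.1 + p.2.2.1.val) / 2 = p.1 := by omega
          have e2 : (2 * p.1 + p.2.2.1.val) % 2 = p.2.2.1 := by omega
          simp [α, ConfigVar.shift_seq, e1, e2]
      · funext p; rcases p with p | p <;> rfl) K w b c (fun l => by
      have h1 := (hw.1 (l 0)).sameType (hz fun i _ => i)
        (fun x : ℕ × Fin q × Fin 2 => toLex (x.2.1.val, pos x.1 x.2.2))
        (fun x => toLex (x.2.1.val, 2 * x.1 + x.2.2)) (fun x y => by
          have h2 : pos x.1 x.2.2 < pos y.1 y.2.2 ↔ 2 * x.1 + x.2.2.val < 2 * y.1 + y.2.2 := by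
            have := x.2.2.2
            have := y.2.2.2
            simp only [pos]
            split_ifs <;> omega
          simp only [Prod.Lex.lt_iff, ofLex_toLex, h2])
      have h2 := h1.comp (fun p : ℕ × Fin q × Fin 2 × Fin n =>
        ((p.1, p.2.1, p.2.2.1), p.2.2.2))
      simp only [hbc]
      exact h2) (fun s₀ s hs₀ hs => by
      have h1 := (hwinv (fun d => bif d then s 0 else fun p => 3 * s₀ (p / 3) + p % 3) (fun d => by
        cases d
        · exact strictMono_block (fun p => p % 3) (fun p => s₀ (p / 3))
            (fun x y h => hs₀.monotone (Nat.div_le_div_right h)) (fun p => Nat.mod_lt _ (by omega))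
            fun i j hij h => by
              have h3 := hs₀.injective h
              show i % 3 < j % 3
              omega
        · exact hs 0)).comp (Sum.elim (fun p : ℕ × Fin q × Fin 2 × Fin n => b p.1 p.2)
          fun p : (Fin 1 → ℕ) × ℕ × Fin q × Fin 2 × Fin n => c p.1 p.2.1 p.2.2)
      convert h1 using 1
      · funext p
        rcases p with p | p
        · have e1 : (3 * p.1 + p.2.2.1.val) / 3 = p.1 := by omega
          have e2 : (3 * p.1 + p.2.2.1.val) % 3 = p.2.2.1 := by omega
          simp [b, RowVar.shift, e1, e2]
        · have e1 : (2 * (3 * p.2.1 + 2) + p.2.2.2.1.val) / 2 = 3 * p.2.1 + 2 := by omega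
          have e2 : (2 * (3 * p.2.1 + 2) + p.2.2.2.1.val) % 2 = p.2.2.2.1 := by omega
          have e3 : (3 * p.2.1 + 2) / 3 = p.2.1 := by omega
          have e4 : (3 * p.2.1 + 2) % 3 = 2 := by omega
          simp [c, RowVar.shift_seq, e1, e2, e3, e4]
      · funext p; rcases p with p | p <;> rfl)
  -- The row becomes indiscernible over `G'` and the base together, so its entries have the same
  -- type over them.
  obtain ⟨P, x, hx1, hx2⟩ := Theory.exists_shift_invariant (RowVar.parShift γ n m) P.is_model
    (Sum.elim G' w')
  have hl : IsTypeLimit L (⊤ : Filter {σ : Unit → ℕ → ℕ // ∀ d, StrictMono (σ d)})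
      (fun σ p => Sum.elim G' w' ((RowVar.parShift γ n m).act σ.1 p)) x := fun ψ hψ =>
    hx1 ψ fun σ hσ => (Filter.eventually_top.1 hψ) ⟨σ, hσ⟩
  have hG : SameType L
      (Sum.elim (fun p => x (Sum.inl p))
        fun p : ℕ × Fin q × Fin 2 × Fin n => x (Sum.inr (interleave b (c fun _ => 0) p.1 p.2)))
      (Sum.elim G fun p => α p.1 p.2) := by
    refine (SameType.of_imp fun ψ hψ => ?_).symm
    have := hl.comp (Sum.elim Sum.inl fun p : ℕ × Fin q × Fin 2 × Fin n =>
      Sum.inr (interleave b (c fun _ => 0) p.1 p.2)) ψ (Filter.Eventually.of_forall fun σ => by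
        convert (hG' (fun _ => σ.1 () 0) ψ).2 hψ using 1
        funext p
        rcases p with p | p
        · rfl
        · simp only [Sum.elim_inr, hbc, RowVar.parShift, Sum.map_inr, RowVar.shift_seq, cond_true,
            cond_false, id, Nat.div_add_mod])
    convert this using 1
    funext p; rcases p with p | p <;> rfl
  have hrow : IsRow a φ k fun p => x (Sum.inr p) :=
    IsRow.of_isTypeLimit (hl.comp Sum.inr) (Filter.Eventually.of_forall fun σ =>
      (hw.of_sameType hw').shift (σ := fun d => bif d then σ.1 () else id) fun d => by
        cases d
        · exact strictMono_id
        · exact σ.2 ())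
  refine ⟨P, fun j y => x (Sum.inr (.par j y)), fun i => Sum.elim (fun p => x (Sum.inl (i, p)))
    (Sum.elim (fun p => x (Sum.inr (.base i (3 * p.1 + 2) p.2)))
      fun p => x (Sum.inr (.ins 0 i (3 * p.1 + 2) p.2))), ?_,
      fun i => ⟨fun p => hrow.2.1 0 i (3 * p + 2), fun j => ?_, hrow.2.2⟩⟩
  · have h1 := hG.comp (fun p : Fin q × PathVar n m t => Sum.elim (fun y => Sum.inl (p.1, y))
      (Sum.elim (fun y => Sum.inr (2 * y.1 + 1, p.1, (0 : Fin 2), y.2))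
        fun y => Sum.inr (2 * y.1 + 1, p.1, (1 : Fin 2), y.2)) p.2)
    have h2 := (hinv (fun d => if d = some none then fun p => 2 * p + 1 else id) (fun d => by
        split_ifs
        · exact fun i j h => by
            show 2 * i + 1 < 2 * j + 1
            omega
        · exact strictMono_id)).comp fun p : Fin q × PathVar n m t =>
          (p.1.val, ConfigVar.path (fun _ => p.1) p.2)
    have e1 : ∀ y, (2 * y + 1) % 2 = 1 := fun y => by omega
    have e2 : ∀ y, (2 * y + 1) / 2 = y := fun y => by omega
    refine SameType.trans ?_ h2
    convert h1 using 1
    · funext p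
      rcases p with ⟨i, y | y | y⟩
      · rfl
      · simp [hbc, pos, e1, e2, RowVar.seq_two_mul]
      · simp [hbc, pos, e1, e2, RowVar.seq_two_mul_add_one]
    · funext p
      rcases p with ⟨i, y | y | y⟩
      · rfl
      · simp [α, ConfigVar.path, ConfigVar.shift, ConfigVar.seq_two_mul]
      · simp [α, ConfigVar.path, ConfigVar.shift, ConfigVar.seq_two_mul_add_one]
  · have h1 := (hx2 (fun _ p => p + j) fun _ p p' h => Nat.add_lt_add_right h j).comp
      (Sum.elim (fun y => Sum.inr (.par 0 y)) (Sum.elim (fun y => Sum.inl (i, y))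
        fun y => Sum.inr (.base i (3 * y.1 + 2) y.2)) :
        Fin m ⊕ ((Fin t × Fin m) ⊕ (ℕ × Fin n)) → γ ⊕ RowVar n m)
    convert h1 using 1
    · funext p
      rcases p with y | y | y <;> simp [RowVar.parShift, RowVar.shift]
    · funext p
      rcases p with y | y | y <;> rfl

/-- A configuration with `t` rows and one with one row yield a configuration with `t + 1` rows. -/
theorem IsConfig.exists_succ (hres : T.IsOmegaResilient) (hntp : T.IsNTP₂) [Nonempty M₀]
    (hM₀ : M₀ ⊨ T) (ha : EMLike L a a) {M : Theory.ModelType.{u, v, max u v} T}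
    {w : ConfigVar n m t → M} (hw : IsConfig a φ k w) {M₁ : Theory.ModelType.{u, v, max u v} T}
    {w₁ : ConfigVar n m 1 → M₁} (hw₁ : IsConfig a φ k w₁) :
    ∃ (N : Theory.ModelType.{u, v, max u v} T) (z : ConfigVar n m (t + 1) → N),
      IsConfig a φ k z := by
  obtain ⟨N, z, hzj, hzr, hzinv⟩ := hw.exists_joint_family hres hntp ha hM₀
  obtain ⟨K, x, hx, hxinv⟩ := hw₁.exists_isRow
  obtain ⟨P, z', y, hz', hy⟩ := hntp.exists_common_realization (Y := ℕ × Fin m) z ConfigVar.path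
    (fun s₀ s hs₀ hs => by
      have := (hzinv (fun d => d.elim s₀ fun d => d.elim id s) (fun d => by
        rcases d with _ | _ | d
        · exact hs₀
        · exact strictMono_id
        · exact hs d)).comp (fun p : ℕ × (Fin t → ℕ) × PathVar n m t =>
          (p.1, ConfigVar.path p.2.1 p.2.2))
      convert this using 1
      funext p
      rcases p with ⟨i, l, y | y | y⟩ <;> rfl)
    (rowFormulas n m t k φ) (fun q => by
      obtain ⟨P, y, e, he, hye⟩ := hx.exists_isRowOver_diagonal hres hntp hzj hzinv hxinv q
      exact ⟨P, fun p => y p.1 p.2, e, he, fun i => isRowOver_iff.1 (hye i)⟩)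
  have hy' : ∀ l, IsRowOver φ k (fun j x => y (j, x)) fun p => z' (ConfigVar.path l p) := fun l =>
    isRowOver_iff.2 (hy l)
  have hseq : ∀ l, EMLike L a fun i x => z' (.seq l i x) := fun l => by
    have h1 := (hzj fun _ => l).comp (f := fun p : ℕ => toLex (0, p)) (fun i i' h =>
      Prod.Lex.lt_iff.2 (Or.inr ⟨rfl, h⟩))
    exact h1.of_sameType (hz'.comp fun p : ℕ × Fin n => ConfigVar.seq l p.1 p.2)
  have hrows : HasRows φ k z' := (hzr 0).of_sameType hz'
  -- All `y j` have the type of `y 0` over the entries of path `l` and the base. Hence the inserted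
  -- sequence of `l`, which solves `φ` at `y 0`, has a conjugate solving it at `y j`; this becomes
  -- the inserted sequence of the path `(l, j)`.
  obtain ⟨Q, v, u, hv, hu⟩ := Theory.exists_amalgam (J := (Fin t → ℕ) × ℕ) (D := ℕ × Fin n)
    (C := Fin m ⊕ ((Fin t × Fin m) ⊕ (ℕ × Fin n))) (N := fun _ => P) P.is_model
    (Sum.elim z' y) (fun j => Sum.elim (fun x => Sum.inr (j.2, x))
      fun p => Sum.inl (ConfigVar.path j.1 (Sum.map id Sum.inl p)))
    (fun j => Sum.elim (Sum.elim (fun x => y (0, x))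
      fun p => z' (ConfigVar.path j.1 (Sum.map id Sum.inl p)))
      fun p => z' (.ins j.1 p.1 p.2)) (fun j => by
      convert (hy' j.1).2.1 j.2 using 1
      · funext x; rcases x with x | x <;> rfl
      · rfl)
  refine ⟨Q, fun
    | .base i x => v (Sum.inl (.base i x))
    | .ins l i x => u (Fin.init l, l (Fin.last t)) (i, x)
    | .row r j x => Fin.lastCases (v (Sum.inr (j, x))) (fun r => v (Sum.inl (.row r j x))) r,
    fun l => ?_, fun l i r => ?_, fun r => ?_⟩
  · have h1 := (hu (Fin.init l, l (Fin.last t))).comp (fun p : ℕ × Fin n =>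
      if p.1 % 2 = 0 then Sum.inl (Sum.inr (Sum.inr (p.1 / 2, p.2))) else Sum.inr (p.1 / 2, p.2))
    refine (hseq (Fin.init l)).of_sameType ?_
    convert h1 using 1 <;>
    · funext p
      unfold ConfigVar.seq interleave
      split_ifs with h <;> rfl
  · have h1 := hu (Fin.init l, l (Fin.last t))
    induction r using Fin.lastCases with
    | last =>
      have h2 := h1.comp (Sum.elim (fun x => Sum.inr (i, x)) fun x => Sum.inl (Sum.inl x) :
        Fin n ⊕ Fin m → _) φ
      refine (iff_of_eq ?_).1 (h2.2 ((iff_of_eq ?_).1 ((hy' (Fin.init l)).1 i)))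
      · congr 1
        funext x; rcases x with x | x <;> simp
      · congr 1
        funext x; rcases x with x | x <;> rfl
    | cast r =>
      have h2 := h1.comp (Sum.elim (fun x => Sum.inr (i, x))
        fun x => Sum.inl (Sum.inr (Sum.inl (r, x))) : Fin n ⊕ Fin m → _) φ
      refine (iff_of_eq ?_).1 (h2.2 ((iff_of_eq ?_).1 (hrows.1 (Fin.init l) i r)))
      · congr 1
        funext x
        rcases x with x | x
        · rfl
        · simp only [Sum.elim_inr, Fin.lastCases_castSucc]; rfl
      · congr 1
        funext x; rcases x with x | x <;> rfl
  · induction r using Fin.lastCases with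
    | last =>
      simp only [Fin.lastCases_last]
      exact (hy' fun _ => 0).2.2.of_sameType (hv.comp fun p : ℕ × Fin m => Sum.inr p)
    | cast r =>
      simp only [Fin.lastCases_castSucc]
      exact (hrows.2 r).of_sameType (hv.comp fun p : ℕ × Fin m =>
        Sum.inl (ConfigVar.row r p.1 p.2))

theorem IsConfig.false_of_isNTP₂ (hres : T.IsOmegaResilient) (hntp : T.IsNTP₂) [Nonempty M₀]
    (hM₀ : M₀ ⊨ T) (ha : EMLike L a a) {M₁ : Theory.ModelType.{u, v, max u v} T}
    {w₁ : ConfigVar n m 1 → M₁} (hw₁ : IsConfig a φ k w₁) : False := by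
  have h : ∀ t, ∃ (N : Theory.ModelType.{u, v, max u v} T) (z : ConfigVar n m (t + 1) → N),
      IsConfig a φ k z := by
    intro t
    induction t with
    | zero => exact ⟨M₁, w₁, hw₁⟩
    | succ t ih =>
      obtain ⟨N, z, hz⟩ := ih
      exact hz.exists_succ hres hntp hM₀ ha hw₁
  obtain ⟨B, hB⟩ := hntp.exists_bound φ k
  -- This gives `B + 1` rows, of which the first `B` are used.
  obtain ⟨N, z, hz⟩ := h B
  obtain ⟨i, hi, S, -, hS, hc⟩ := hB N (fun i j x => z (.row (Fin.ofNat (B + 1) i) j x))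
    fun η _ => ⟨fun x => z (.ins (fun r => η r) 0 x), fun i hi => by
      have := hz.2.1 (fun r => η r) 0 (Fin.ofNat (B + 1) i)
      have e : ((Fin.ofNat (B + 1) i : Fin (B + 1)) : ℕ) = i :=
        Nat.mod_eq_of_lt (Nat.lt_succ_of_lt hi)
      rwa [e] at this⟩
  exact hz.2.2 _ S hS hc

end Path

/-! ### From dividing to a one-row configuration, and the conclusion. -/

section Dividing

variable {n m k : ℕ} {φ : L.Formula (Fin n ⊕ Fin m)} {M : Type w₁} [L.Structure M]
  {a : ℕ → Fin n → M} {N : Type w₂} [L.Structure N]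

/-- If `φ(a i, b)` holds for odd `i`, and `φ(x, b)` divides over the other terms of the sequence,
there is a configuration with one row. -/
theorem exists_isConfig_one [Nonempty M] [Nonempty N] (hN : N ⊨ T) (ha : EMLike L a a)
    (b : Fin m → M) (hφ : ∀ i, φ.Realize (Sum.elim (a (2 * i + 1)) b)) (c : ℕ → Fin n → N)
    (d : ℕ → Fin m → N) (hd : ∀ j, SameType L (Sum.elim (fun p : ℕ × Fin n => c p.1 p.2) (d j))
      (Sum.elim (fun p : ℕ × Fin n => a (2 * p.1) p.2) b)) (hk : InconsistentFamily k φ d) :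
    ∃ (K : Theory.ModelType.{u, v, max u v} T) (z : ConfigVar n m 1 → K), IsConfig a φ k z := by
  -- Each `d j` has the type of `b` over the even terms, so the odd terms of `a` have a conjugate
  -- related to `d j` as they are to `b`.
  obtain ⟨K, v, u, hv, hu⟩ := Theory.exists_amalgam (J := ℕ) (D := ℕ × Fin n) (N := fun _ => M) hN
    (Sum.elim (fun p : ℕ × Fin n => c p.1 p.2) fun p : ℕ × Fin m => d p.1 p.2)
    (fun j => Sum.map id fun x => (j, x))
    (fun _ => Sum.elim (Sum.elim (fun p : ℕ × Fin n => a (2 * p.1) p.2) b)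
      fun p => a (2 * p.1 + 1) p.2) (fun j => by
      convert hd j using 1
      · funext x; rcases x with x | x <;> rfl
      · rfl)
  refine ⟨K, fun
    | .base i x => v (Sum.inl (i, x))
    | .ins l i x => u (l 0) (i, x)
    | .row r j x => v (Sum.inr (j, x)), fun l => ?_, fun l i r => ?_, fun r => ?_⟩
  · have h1 := (hu (l 0)).comp (fun p : ℕ × Fin n =>
      if p.1 % 2 = 0 then Sum.inl (Sum.inl (p.1 / 2, p.2)) else Sum.inr (p.1 / 2, p.2))
    refine ha.of_sameType ?_
    convert h1 using 1
    · funext p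
      unfold ConfigVar.seq interleave
      split_ifs with h <;> rfl
    · funext p
      split_ifs with h
      · show a p.1 p.2 = a (2 * (p.1 / 2)) p.2
        rw [show 2 * (p.1 / 2) = p.1 by omega]
      · show a p.1 p.2 = a (2 * (p.1 / 2) + 1) p.2
        rw [show 2 * (p.1 / 2) + 1 = p.1 by omega]
  · have h2 := (hu (l 0)).comp (Sum.elim (fun x => Sum.inr (i, x)) fun x => Sum.inl (Sum.inr x) :
      Fin n ⊕ Fin m → _) φ
    refine (iff_of_eq ?_).1 (h2.2 ((iff_of_eq ?_).1 (hφ i)))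
    · congr 1
      funext x
      rcases x with x | x
      · rfl
      · rw [Subsingleton.elim r 0]; rfl
    · congr 1
      funext x; rcases x with x | x <;> rfl
  · exact hk.of_sameType (hv.comp fun p : ℕ × Fin m => Sum.inr p)

theorem SameTypeOver.sameType {M : Type w} [L.Structure M]
    {N : Type*} [L.Structure N] (f : M ↪ₑ[L] N) {m : ℕ} {A : Set M} {b : Fin m → M} {d : Fin m → N}

    (h : SameTypeOver L (f '' A) d (f ∘ b)) {V : Type*} (c : V → M) (hc : ∀ x, c x ∈ A) :
    SameType L (Sum.elim (fun x => f (c x)) d) (Sum.elim c b) := by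
  intro ψ
  have h1 := h (ψ.relabel (Sum.map (fun x => ⟨f (c x), Set.mem_image_of_mem f (hc x)⟩) id))
  rw [Formula.realize_relabel, Formula.realize_relabel] at h1
  have h2 := f.map_formula ψ (Sum.elim c b)
  refine Iff.trans ?_ h2
  convert h1 using 2 <;>
  · funext x; rcases x with x | x <;> rfl

end Dividing

end FirstOrder.Language

theorem theorem4p4 {L : FirstOrder.Language.{u, v}} (T : L.Theory) (hT : T.IsComplete)
    (hres : T.IsOmegaResilient) (hntp : T.IsNTP₂)
    {M : Type w} [L.Structure M] [Nonempty M] (hM : M ⊨ T)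
    {n m : ℕ} (a : ℕ → Fin n → M) (ha : FirstOrder.Language.IndiscernibleSeq L a)
    (φ : L.Formula (Fin n ⊕ Fin m)) (b : Fin m → M)
    (hdiv : FirstOrder.Language.Divides φ b {c : M | ∃ (i : ℕ) (j : Fin n), c = a (2 * i) j}) :
    ∀ᶠ i : ℕ in Filter.cofinite, ¬ φ.Realize (Sum.elim (a i) b) := by
  by_contra hcon
  obtain ⟨N, _, f, k, d, hd, hk⟩ := hdiv
  have : Nonempty N := Nonempty.map f inferInstance
  have hN : N ⊨ T := (f.theory_model_iff T).1 hM
  have hodd : ∀ i, φ.Realize (Sum.elim (a i) b) → i % 2 = 1 := by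
    intro i hi
    by_contra h
    -- For even `i` the tuple `a i` lies in the base, so it solves `φ(x, d j)` for all `j` at once.
    refine hk (Finset.range k) (Finset.card_range k) ⟨f ∘ a i, fun j _ => ?_⟩
    exact (FirstOrder.Language.SameTypeOver.sameType f (hd j) (a i)
      (fun x => ⟨i / 2, x, by rw [show 2 * (i / 2) = i by omega]⟩) φ).2 hi
  have hinf : {i | φ.Realize (Sum.elim (a i) b)}.Infinite := by
    intro h
    exact hcon (by simpa only [Filter.eventually_cofinite, not_not] using h)
  let o := Nat.nth fun i => φ.Realize (Sum.elim (a i) b)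
  have ho : StrictMono o := Nat.nth_strictMono hinf
  have hoφ : ∀ i, φ.Realize (Sum.elim (a (o i)) b) := fun i => Nat.nth_mem_of_infinite hinf i
  -- Each odd index `o i` where `φ` holds is kept together with the even index just before it, so
  -- that the thinned sequence again alternates between base terms and solutions.
  let s : ℕ → ℕ := fun p => o (p / 2) - 1 + p % 2
  have hs : StrictMono s := by
    intro p q hpq
    have h1 := hodd _ (hoφ (p / 2))
    have h2 := hodd _ (hoφ (q / 2))
    show o (p / 2) - 1 + p % 2 < o (q / 2) - 1 + q % 2
    rcases (Nat.div_le_div_right (c := 2) hpq.le).lt_or_eq with h | h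
    · have := ho h; omega
    · rw [h]; omega
  have ha' : FirstOrder.Language.EMLike L (fun i => a (s i)) fun i => a (s i) :=
    (ha.emLike.comp hs).self
  have hs1 : ∀ i, s (2 * i + 1) = o i := fun i => by
    have := hodd _ (hoφ i)
    simp only [s]
    rw [show (2 * i + 1) / 2 = i by omega]
    omega
  have hs0 : ∀ i, s (2 * i) = 2 * (o i / 2) := fun i => by
    have := hodd _ (hoφ i)
    simp only [s]
    rw [show 2 * i / 2 = i by omega]
    omega
  obtain ⟨K, z, hz⟩ := FirstOrder.Language.exists_isConfig_one hN ha' b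
    (fun i => by rw [hs1]; exact hoφ i) (fun i x => f (a (s (2 * i)) x)) d
    (fun j => FirstOrder.Language.SameTypeOver.sameType f (hd j)
      (fun p : ℕ × Fin n => a (s (2 * p.1)) p.2) fun p => ⟨o p.1 / 2, p.2, by rw [hs0]⟩) hk
  exact hz.false_of_isNTP₂ hres hntp hM ha'
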